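/- Let $\nu\ge 3$ and let $M$ be a compact embedded $C^\nu$ submanifold of $\mathbb{R}^q$, with the induced Riemannian metric, Levi-Civita connection $\nabla$ and curvature tensor $R(X,Y)=\nabla_X\nabla_Y-\nabla_Y\nabla_X-\nabla_{[X,Y]}$. Write $S^1=\mathbb{R}/2\pi\mathbb{Z}$, let $\mathrm{W}^{2,2}_\iota(S^1,M)$ be the set of $u\in \mathrm{W}^{2,2}(S^1,\mathbb{R}^q)$ with $u(t)\in M$ and $\dot u(t)\ne 0$ for all $t$, and for such $u$ let $\mathrm{W}^{2,2}_u(S^1,TM)$ be the space of $v\in \mathrm{W}^{2,2}(S^1,\mathbb{R}^q)$ with $v(t)\in T_{u(t)}M$ for all $t$. Put $T=\dot u/|\dot u|$, $D_t=\nabla_{T}$ (derivative with respect to arc length), $K=D_tT$, $\kappa(u)=|K|$, $ds=|\dot u|\,dt$ and, for $\sigma\ge 0$, $$E_\sigma(u)=\int_{S^1}\bigl(1+\sigma^2\kappa(u)^2\bigr)|\dot u|\,dt .$$ A curve $u\in \mathrm{W}^{2,2}_\iota(S^1,M)$ is a critical point of $E_\sigma$ if $DE_\sigma(u)\cdot v=0$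 for all $v\in\mathrm{W}^{2,2}_u(S^1,TM)$. The second variation of $E_\sigma$ at a critical point $u$ in the direction $v\in\mathrm{W}^{2,2}_u(S^1,TM)$ is $$\begin{aligned} D^2E_\sigma(u)[v,v]={}&2\sigma^2\int_{S^1}\Bigl\{|D_t^2v|^2+|R(v,T)T|^2+2\bigl(6\langle D_tv,T\rangle^2-|D_tv|^2+\langle R(T,v)v,T\rangle\bigr)\kappa^2\\ &\quad-\bigl(\langle D_t^2v,T\rangle+\langle D_tv,K\rangle\bigr)^2-8\langle D_tv,T\rangle\langle D_t^2v,K\rangle+\langle(\nabla_{T}R)(v,T)v,K\rangle+\langle(\nabla_vR)(v,T)T,K\rangle\\ &\quad+\langle R(D_tv,T)v,K\rangle-\langle R(K,v)v,K\rangle+3\langle R(v,T)D_tv,K\rangle+\langle R(v,D_tv)T,K\rangle\\ &\quad+2\langle R(v,T)T,D_t^2v\rangle-8\langle D_tv,T\rangle\langle R(v,T)T,K\rangle\Bigr\}\,ds\\ &+4\sigma^2\int_{S^1}\langle D_tv,T\rangle\bigl(\langle D_t^2v,K\rangle-2\langle D_tv,T\rangle\kappa^2+\langle R(v,T)T,K\rangle\bigr)\,ds\\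 &+\int_{S^1}(1+\sigma^2\kappa^2)\bigl(|D_tv|^2-\langle D_tv,T\rangle^2-\langle R(T,v)v,T\rangle\bigr)\,ds . \end{aligned}$$ The index $\mathrm{Ind}(u)\in\mathbb{N}\cup\{\infty\}$ of a critical point $u$ of $E_\sigma$ is the largest dimension of a linear subspace of $\mathrm{W}^{2,2}_u(S^1,TM)$ on which $D^2E_\sigma(u)$ is negative definite. **Theorem.** Let $\sigma_n>0$ with $\sigma_n\to 0$ and, for each $n$, let $u_n\in\mathrm{W}^{2,2}_\iota(S^1,M)$ be a critical point of $E_{\sigma_n}$, parametrized with constant speed, such that $$\sigma_n^2\int_{S^1}\kappa(u_n)^2|\dot u_n|\,dt\longrightarrow 0 .$$ Assume that $u_n\to u$ in $L^\infty(S^1)$ and $\dot u_n\to\dot u$ almost everywhere, where $u\in\mathrm{W}^{2,2}_\iota(S^1,M)$ is a closed (non-trivial) geodesic. Then $$\mathrm{Ind}(u)\le\liminf_{n\to\infty}\mathrm{Ind}(u_n),$$ where $\mathrm{Ind}(u_n)$ is the index of $u_n$ as a critical point of $E_{\sigma_n}$ and $\mathrm{Ind}(u)$ is the index of $u$ as a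 critical point of $E_0$, the length. In particular this applies when $E_{\sigma_n}(u_n)=\beta(\sigma_n)$ are min-max values and $\sigma_n^2\int_{S^1}\kappa(u_n)^2|\dot u_n|\,dt\le 1/\log(1/\sigma_n)$ for all large $n$. -/

import Mathlib

open Set Filter Topology MeasureTheory
open scoped Real InnerProductSpace

noncomputable section

namespace ViscosityGeodesic

/-- `M` is an embedded `m`-dimensional submanifold of class `C^ν` of `ℝ^q`: around each of its
points there is a `C^ν` diffeomorphism between open subsets of `ℝ^q` that flattens `M` onto an
`m`-dimensional linear subspace. -/
def IsSubmanifold {q : ℕ} (ν : ℕ∞) (m : ℕ) (M : Set (EuclideanSpace ℝ (Fin q))) : Prop :=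
  ∀ x ∈ M, ∃ Φ : OpenPartialHomeomorph (EuclideanSpace ℝ (Fin q)) (EuclideanSpace ℝ (Fin q)),
    x ∈ Φ.source ∧ ContDiffOn ℝ ν Φ Φ.source ∧ ContDiffOn ℝ ν Φ.symm Φ.target ∧
    ∃ V : Submodule ℝ (EuclideanSpace ℝ (Fin q)), Module.finrank ℝ V = m ∧
      ∀ y ∈ Φ.source, y ∈ M ↔ Φ y ∈ V

/-- The tangent space `T_x M`, as a linear subspace of `ℝ^q`. -/
def tangentSpaceAt {q : ℕ} (M : Set (EuclideanSpace ℝ (Fin q))) (x : EuclideanSpace ℝ (Fin q)) :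
    Submodule ℝ (EuclideanSpace ℝ (Fin q)) :=
  Submodule.span ℝ (tangentConeAt ℝ M x)

/-- The orthogonal projection `P(x) : ℝ^q → T_x M`. -/
def tangentProj {q : ℕ} (M : Set (EuclideanSpace ℝ (Fin q))) (x : EuclideanSpace ℝ (Fin q)) :
    EuclideanSpace ℝ (Fin q) →L[ℝ] EuclideanSpace ℝ (Fin q) :=
  (tangentSpaceAt M x).starProjection

/-- The derivative of the map `P` along `M` at `x ∈ M` in the direction `X`. It is used only for
`X ∈ T_x M`, where it does not depend on how `P` is extended off `M`. -/
def tangentProjDeriv {q : ℕ} (M : Set (EuclideanSpace ℝ (Fin q))) (x X : EuclideanSpace ℝ (Fin q)) :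
    EuclideanSpace ℝ (Fin q) →L[ℝ] EuclideanSpace ℝ (Fin q) :=
  fderivWithin ℝ (tangentProj M) M x X

/-- The Riemann curvature tensor `R(X, Y) Z = ∇_X ∇_Y Z - ∇_Y ∇_X Z - ∇_{[X, Y]} Z` of the induced
metric. For a submanifold of `ℝ^q` one has `∇_X Z = P (∂_X Z)`, whence
`R(X, Y) Z = P ((∂_X P) (∂_Y P) Z - (∂_Y P) (∂_X P) Z)` for tangent `X, Y, Z`. The arguments are
projected first, so that for fixed `X, Y, Z ∈ ℝ^q` this is a tangent vector field on `M`. -/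
def curvature {q : ℕ} (M : Set (EuclideanSpace ℝ (Fin q)))
    (x X Y Z : EuclideanSpace ℝ (Fin q)) : EuclideanSpace ℝ (Fin q) :=
  tangentProj M x
    (tangentProjDeriv M x (tangentProj M x X)
        (tangentProjDeriv M x (tangentProj M x Y) (tangentProj M x Z))
      - tangentProjDeriv M x (tangentProj M x Y)
        (tangentProjDeriv M x (tangentProj M x X) (tangentProj M x Z)))

/-- The covariant derivative `(∇_W R)(X, Y) Z` of the curvature tensor, for `W, X, Y, Z ∈ T_x M`.
Here `X, Y, Z` are extended to the tangent fields `y ↦ P(y) X`, `P(y) Y`, `P(y) Z` on `M`, all of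
whose covariant derivatives vanish at `x` because `P (∂_W P) P = 0`. -/
def curvatureDeriv {q : ℕ} (M : Set (EuclideanSpace ℝ (Fin q)))
    (x W X Y Z : EuclideanSpace ℝ (Fin q)) : EuclideanSpace ℝ (Fin q) :=
  tangentProj M x (fderivWithin ℝ (fun y => curvature M y X Y Z) M x W)

/-- `W^{2,2}(S^1, ℝ^q)` with `S^1 = ℝ / 2πℤ`, each class being identified with its `C^1`
representative: a `2π`-periodic `C^1` function whose derivative is an indefinite integral of a
square-integrable function. -/
structure IsW22 {q : ℕ} (f : ℝ → EuclideanSpace ℝ (Fin q)) : Prop where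
  periodic : Function.Periodic f (2 * π)
  contDiff : ContDiff ℝ 1 f
  exists_second_deriv : ∃ g : ℝ → EuclideanSpace ℝ (Fin q),
    MemLp g 2 (volume.restrict (Ioc 0 (2 * π))) ∧
      ∀ t ∈ Icc (0 : ℝ) (2 * π), deriv f t = deriv f 0 + ∫ s in (0 : ℝ)..t, g s

/-- The square of the `W^{2,2}(S^1, ℝ^q)` norm. -/
def w22NormSq {q : ℕ} (f : ℝ → EuclideanSpace ℝ (Fin q)) : ℝ :=
  ∫ t in (0 : ℝ)..(2 * π), (‖f t‖ ^ 2 + ‖deriv f t‖ ^ 2 + ‖deriv (deriv f) t‖ ^ 2)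

/-- The space `W_ι^{2,2}(S^1, M)` of Sobolev immersions. -/
structure IsImmersion {q : ℕ} (M : Set (EuclideanSpace ℝ (Fin q)))
    (u : ℝ → EuclideanSpace ℝ (Fin q)) : Prop where
  isW22 : IsW22 u
  mem : ∀ t, u t ∈ M
  deriv_ne_zero : ∀ t, deriv u t ≠ 0

theorem IsW22.zero {q : ℕ} : IsW22 (0 : ℝ → EuclideanSpace ℝ (Fin q)) where
  periodic := fun _ => rfl
  contDiff := contDiff_const
  exists_second_deriv := ⟨0, MemLp.zero, fun t _ => by simp⟩

theorem IsW22.add {q : ℕ} {f g : ℝ → EuclideanSpace ℝ (Fin q)} (hf : IsW22 f) (hg : IsW22 g) :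
    IsW22 (f + g) where
  periodic := hf.periodic.add hg.periodic
  contDiff := hf.contDiff.add hg.contDiff
  exists_second_deriv := by
    obtain ⟨a, ha, ha'⟩ := hf.exists_second_deriv
    obtain ⟨b, hb, hb'⟩ := hg.exists_second_deriv
    have hd : ∀ t, deriv (f + g) t = deriv f t + deriv g t := fun t =>
      deriv_add (hf.contDiff.differentiable one_ne_zero t)
        (hg.contDiff.differentiable one_ne_zero t)
    refine ⟨a + b, ha.add hb, fun t ht => ?_⟩
    have hi : ∀ c : ℝ → EuclideanSpace ℝ (Fin q),
        MemLp c 2 (volume.restrict (Ioc 0 (2 * π))) → IntervalIntegrable c volume 0 t := by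
      intro c hc
      rw [intervalIntegrable_iff_integrableOn_Ioc_of_le ht.1]
      exact IntegrableOn.mono_set (hc.integrable one_le_two) (Ioc_subset_Ioc_right ht.2)
    rw [hd, hd, ha' t ht, hb' t ht]
    simp only [Pi.add_apply]
    rw [intervalIntegral.integral_add (hi a ha) (hi b hb)]
    abel

theorem IsW22.smul {q : ℕ} {f : ℝ → EuclideanSpace ℝ (Fin q)} (c : ℝ) (hf : IsW22 f) :
    IsW22 (c • f) where
  periodic := hf.periodic.smul c
  contDiff := contDiff_const.smul hf.contDiff
  exists_second_deriv := by
    obtain ⟨a, ha, ha'⟩ := hf.exists_second_deriv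
    have hd : ∀ t, deriv (c • f) t = c • deriv f t := fun t =>
      deriv_const_smul c (hf.contDiff.differentiable one_ne_zero t)
    refine ⟨c • a, ha.const_smul c, fun t ht => ?_⟩
    rw [hd, hd, ha' t ht]
    simp only [Pi.smul_apply]
    rw [intervalIntegral.integral_smul, smul_add]

/-- The vector space `W_u^{2,2}(S^1, TM)` of tangent vector fields along `u`. -/
def fieldsAlong {q : ℕ} (M : Set (EuclideanSpace ℝ (Fin q)))
    (u : ℝ → EuclideanSpace ℝ (Fin q)) : Submodule ℝ (ℝ → EuclideanSpace ℝ (Fin q)) where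
  carrier := {v | IsW22 v ∧ ∀ t, v t ∈ tangentSpaceAt M (u t)}
  zero_mem' := ⟨IsW22.zero, fun _ => Submodule.zero_mem _⟩
  add_mem' := fun ha hb => ⟨ha.1.add hb.1, fun t => Submodule.add_mem _ (ha.2 t) (hb.2 t)⟩
  smul_mem' := fun c _ ha => ⟨ha.1.smul c, fun t => Submodule.smul_mem _ c (ha.2 t)⟩

/-- The covariant derivative `D_t w = ∇_{u̇/|u̇|} w` with respect to arc length, along the curve
`u`, of a tangent field `w` along `u`. -/
def covDeriv {q : ℕ} (M : Set (EuclideanSpace ℝ (Fin q)))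
    (u w : ℝ → EuclideanSpace ℝ (Fin q)) (t : ℝ) : EuclideanSpace ℝ (Fin q) :=
  ‖deriv u t‖⁻¹ • tangentProj M (u t) (deriv w t)

/-- The unit tangent vector `u̇/|u̇|`. -/
def unitTangent {q : ℕ} (u : ℝ → EuclideanSpace ℝ (Fin q)) (t : ℝ) : EuclideanSpace ℝ (Fin q) :=
  ‖deriv u t‖⁻¹ • deriv u t

/-- The geodesic curvature vector `∇_{u̇/|u̇|} (u̇/|u̇|)`; its norm is `κ(u)`. -/
def curvatureVector {q : ℕ} (M : Set (EuclideanSpace ℝ (Fin q)))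
    (u : ℝ → EuclideanSpace ℝ (Fin q)) : ℝ → EuclideanSpace ℝ (Fin q) :=
  covDeriv M u (unitTangent u)

/-- The geodesic curvature `κ(u)`. -/
def geodesicCurvature {q : ℕ} (M : Set (EuclideanSpace ℝ (Fin q)))
    (u : ℝ → EuclideanSpace ℝ (Fin q)) (t : ℝ) : ℝ :=
  ‖curvatureVector M u t‖

/-- The energy `E_σ(u) = ∫_{S^1} (1 + σ² κ(u)²) |u̇|`. -/
def energy {q : ℕ} (M : Set (EuclideanSpace ℝ (Fin q))) (σ : ℝ)
    (u : ℝ → EuclideanSpace ℝ (Fin q)) : ℝ :=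
  ∫ t in (0 : ℝ)..(2 * π), (1 + σ ^ 2 * geodesicCurvature M u t ^ 2) * ‖deriv u t‖

/-- `γ` is a curve in `W_ι^{2,2}(S^1, M)` through `u = γ(0)` which is differentiable at `0`, as a
curve in the Hilbert space `W^{2,2}(S^1, ℝ^q)`, with velocity `v`. -/
structure IsVariation {q : ℕ} (M : Set (EuclideanSpace ℝ (Fin q)))
    (u v : ℝ → EuclideanSpace ℝ (Fin q)) (γ : ℝ → ℝ → EuclideanSpace ℝ (Fin q)) : Prop where
  isImmersion : ∀ᶠ s in 𝓝 (0 : ℝ), IsImmersion M (γ s)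
  initial : γ 0 = u
  velocity : (fun s : ℝ => √(w22NormSq (γ s - u - s • v))) =o[𝓝 0] (fun s : ℝ => s)

/-- `u` is a critical point of `E_σ` on `W_ι^{2,2}(S^1, M)`: `DE_σ(u) · v = 0` for every
`v ∈ W_u^{2,2}(S^1, TM)`. -/
def IsCritical {q : ℕ} (M : Set (EuclideanSpace ℝ (Fin q))) (σ : ℝ)
    (u : ℝ → EuclideanSpace ℝ (Fin q)) : Prop :=
  IsImmersion M u ∧ ∀ v ∈ fieldsAlong M u, ∀ γ : ℝ → ℝ → EuclideanSpace ℝ (Fin q),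
    IsVariation M u v γ → HasDerivAt (fun s => energy M σ (γ s)) 0 0

/-- `u : S^1 → M` is a closed geodesic: an immersion with `D_t u̇ = 0`. It is non-trivial, since
`u̇` vanishes nowhere. -/
def IsClosedGeodesic {q : ℕ} (M : Set (EuclideanSpace ℝ (Fin q)))
    (u : ℝ → EuclideanSpace ℝ (Fin q)) : Prop :=
  IsImmersion M u ∧ ∀ᵐ t, covDeriv M u (deriv u) t = 0

/-- The `σ²`-part of the second variation: one half of the second derivative, at `s = 0`, of the
squared geodesic curvature along the geodesic variation of `u` in the direction `v`.
Below `T = u̇/|u̇|`, `K = D_t T`, `R` is the curvature tensor at `u(t)`. -/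
def curvatureSecondVariation {q : ℕ} (M : Set (EuclideanSpace ℝ (Fin q)))
    (u v : ℝ → EuclideanSpace ℝ (Fin q)) (t : ℝ) : ℝ :=
  let T := unitTangent u t
  let K := curvatureVector M u t
  let V := v t
  let DV := covDeriv M u v t
  let DDV := covDeriv M u (covDeriv M u v) t
  let R := curvature M (u t)
  let DR := curvatureDeriv M (u t)
  ‖DDV‖ ^ 2 + ‖R V T T‖ ^ 2
    + 2 * (4 * ⟪DV, T⟫_ℝ ^ 2 + 2 * ⟪DV, T⟫_ℝ ^ 2 - ‖DV‖ ^ 2 + ⟪R T V V, T⟫_ℝ) * ‖K‖ ^ 2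
    - (⟪DDV, T⟫_ℝ + ⟪DV, K⟫_ℝ) ^ 2 - 8 * ⟪DV, T⟫_ℝ * ⟪DDV, K⟫_ℝ
    + ⟪DR T V T V, K⟫_ℝ + ⟪DR V V T T, K⟫_ℝ
    + ⟪R DV T V, K⟫_ℝ - ⟪R K V V, K⟫_ℝ + 3 * ⟪R V T DV, K⟫_ℝ + ⟪R V DV T, K⟫_ℝ
    + 2 * ⟪R V T T, DDV⟫_ℝ - 8 * ⟪DV, T⟫_ℝ * ⟪R V T T, K⟫_ℝ

/-- The second variation `D²E_σ(u)[v, v]` of `E_σ` at a critical point `u`, in the direction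
`v ∈ W_u^{2,2}(S^1, TM)`; the integrals over `S^1` are with respect to arc length `|u̇| dt`. -/
def secondVariation {q : ℕ} (M : Set (EuclideanSpace ℝ (Fin q))) (σ : ℝ)
    (u v : ℝ → EuclideanSpace ℝ (Fin q)) : ℝ :=
  2 * σ ^ 2 * (∫ t in (0 : ℝ)..(2 * π), curvatureSecondVariation M u v t * ‖deriv u t‖)
    + 4 * σ ^ 2 * (∫ t in (0 : ℝ)..(2 * π),
        ⟪covDeriv M u v t, unitTangent u t⟫_ℝ *
          (⟪covDeriv M u (covDeriv M u v) t, curvatureVector M u t⟫_ℝ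
            - 2 * ⟪covDeriv M u v t, unitTangent u t⟫_ℝ * geodesicCurvature M u t ^ 2
            + ⟪curvature M (u t) (v t) (unitTangent u t) (unitTangent u t),
                curvatureVector M u t⟫_ℝ) * ‖deriv u t‖)
    + ∫ t in (0 : ℝ)..(2 * π),
        (1 + σ ^ 2 * geodesicCurvature M u t ^ 2) *
          (‖covDeriv M u v t‖ ^ 2 - ⟪covDeriv M u v t, unitTangent u t⟫_ℝ ^ 2
            - ⟪curvature M (u t) (unitTangent u t) (v t) (v t), unitTangent u t⟫_ℝ)
          * ‖deriv u t‖

/-- `D²E_σ(u)` is negative definite on the linear subspace `V` of `W_u^{2,2}(S^1, TM)`. -/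
def IsNegDefOn {q : ℕ} (M : Set (EuclideanSpace ℝ (Fin q))) (σ : ℝ)
    (u : ℝ → EuclideanSpace ℝ (Fin q)) (V : Submodule ℝ (ℝ → EuclideanSpace ℝ (Fin q))) : Prop :=
  V ≤ fieldsAlong M u ∧ ∀ v ∈ V, v ≠ 0 → secondVariation M σ u v < 0

/-- The index `Ind(u) ∈ ℕ ∪ {∞}` of a critical point `u` of `E_σ`: the largest dimension of a linear
subspace of `W_u^{2,2}(S^1, TM)` on which `D²E_σ(u)` is negative definite. -/
def index {q : ℕ} (M : Set (EuclideanSpace ℝ (Fin q))) (σ : ℝ)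
    (u : ℝ → EuclideanSpace ℝ (Fin q)) : ℕ∞ :=
  ⨆ V : {V : Submodule ℝ (ℝ → EuclideanSpace ℝ (Fin q)) // IsNegDefOn M σ u V},
    Cardinal.toENat (Module.rank ℝ V.1)

end ViscosityGeodesic

end

/-! The second variation of the length depends only on the first jets of the curve and of the field.
Let `A` be a `C²` map on `ℝ^q` extending the tangential projection of `M` near the image of `u₀`.
A field `v` along `u₀` is transported to the tangent field `A(u_n) v` along `u_n`. The first jets
of these fields are bounded and converge almost everywhere, so by dominated convergence the
`σ_n`-free part of the second variation converges to the second variation of the length. The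
remaining part is `σ_n²` times the integral of a quantity which is quadratic in `(1, K, v̈)`, with
coefficients bounded in terms of the first jets; hence it is at most a constant times
`σ_n² ∫ (1 + κ(u_n)² + |v̈|²)`, which tends to `0`. All of this is uniform for `v` near a given
element of a finite-dimensional space of fields. If the second variation of the length is negative
definite on that space then, the unit sphere being compact, so is the second variation of
`E_{σ_n}` at `u_n` on the transported space for all large `n`. -/

noncomputable section

namespace ViscosityGeodesic

variable {q : ℕ}

local notation "𝔼" => EuclideanSpace ℝ (Fin q)

section ImageProjection

variable {E : Type*} [NormedAddCommGroup E] [InnerProductSpace ℝ E] [FiniteDimensional ℝ E]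

/-- The Gram operator of `B ∘ π_V`, completed by the identity on the orthogonal complement of `V`
so as to be invertible as soon as `B` is injective. -/
def gramOperator (V : Submodule ℝ E) (B : E →L[ℝ] E) : E →L[ℝ] E :=
  star (B * V.starProjection) * (B * V.starProjection) + (1 - V.starProjection)

/-- The expression `S N⁻¹ S*`, with `S = B ∘ π_V` and `N` its Gram operator, for the orthogonal
projection onto `B(V)`. It exhibits this projection as a smooth function of `B`. -/
def imageProjection (V : Submodule ℝ E) (B : E →L[ℝ] E) : E →L[ℝ] E :=
  (B * V.starProjection) * Ring.inverse (gramOperator V B) * star (B * V.starProjection)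

theorem inner_gramOperator_self (V : Submodule ℝ E) (B : E →L[ℝ] E) (x : E) :
    ⟪gramOperator V B x, x⟫_ℝ =
      ‖B (V.starProjection x)‖ ^ 2 + ‖x - V.starProjection x‖ ^ 2 := by
  have hGram : ⟪star (B * V.starProjection) ((B * V.starProjection) x), x⟫_ℝ =
      ‖B (V.starProjection x)‖ ^ 2 := by
    rw [ContinuousLinearMap.star_eq_adjoint, ContinuousLinearMap.adjoint_inner_left,
      real_inner_self_eq_norm_sq, mul_apply_eq_comp]
  have hcompl : ⟪x - V.starProjection x, x⟫_ℝ = ‖x - V.starProjection x‖ ^ 2 := by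
    have horth : ⟪x - V.starProjection x, V.starProjection x⟫_ℝ = 0 :=
      Submodule.inner_left_of_mem_orthogonal (Submodule.starProjection_apply_mem _ _)
        (Submodule.sub_starProjection_mem_orthogonal x)
    rw [← real_inner_self_eq_norm_sq, inner_sub_right _ x, horth, sub_zero]
  rw [← hGram, ← hcompl, ← inner_add_left]
  rfl

theorem isUnit_gramOperator (V : Submodule ℝ E) {B : E →L[ℝ] E} (hB : Function.Injective B) :
    IsUnit (gramOperator V B) := by
  rw [ContinuousLinearMap.isUnit_iff_isUnit_toLinearMap, LinearMap.isUnit_iff_ker_eq_bot,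
    LinearMap.ker_eq_bot']
  intro x hx
  have hsum := inner_gramOperator_self V B x
  rw [show gramOperator V B x = 0 from hx, inner_zero_left, eq_comm,
    add_eq_zero_iff_of_nonneg (sq_nonneg _) (sq_nonneg _), sq_eq_zero_iff, sq_eq_zero_iff,
    norm_eq_zero, norm_eq_zero, sub_eq_zero] at hsum
  rw [hsum.2]
  exact hB (hsum.1.trans (map_zero B).symm)

theorem imageProjection_mul (V : Submodule ℝ E) {B : E →L[ℝ] E} (hB : Function.Injective B) :
    imageProjection V B * (B * V.starProjection) = B * V.starProjection := by
  set S := B * V.starProjection with hS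
  have hSp : S * V.starProjection = S := by rw [hS, mul_assoc, V.isIdempotentElem_starProjection.eq]
  have hNp : gramOperator V B * V.starProjection = star S * S := by
    rw [gramOperator, add_mul, mul_assoc, hSp, sub_mul, V.isIdempotentElem_starProjection.eq,
      one_mul, sub_self, add_zero]
  rw [imageProjection, ← hS, mul_assoc, ← hNp, mul_assoc,
    Ring.inverse_mul_cancel_left _ _ (isUnit_gramOperator V hB), hSp]

theorem star_imageProjection (V : Submodule ℝ E) (B : E →L[ℝ] E) :
    star (imageProjection V B) = imageProjection V B := by
  have hN : star (gramOperator V B) = gramOperator V B := by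
    simp [gramOperator, (isSelfAdjoint_starProjection V).star_eq]
  rw [imageProjection, star_mul (_ * _), star_mul (B * _), star_star, ← Ring.inverse_star, hN,
    mul_assoc (B * _)]

theorem imageProjection_eq (V : Submodule ℝ E) {B : E →L[ℝ] E} (hB : Function.Injective B) :
    imageProjection V B = (V.map B.toLinearMap).starProjection := by
  ext1 x
  have hmem : imageProjection V B x ∈ V.map B.toLinearMap :=
    Submodule.mem_map_of_mem (Submodule.starProjection_apply_mem V _)
  refine (Submodule.eq_starProjection_of_mem_of_inner_eq_zero hmem ?_).symm
  rintro _ ⟨v, hv, rfl⟩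
  have hfix : imageProjection V B (B v) = B v := by
    simpa [Submodule.starProjection_eq_self_iff.mpr hv] using
      DFunLike.congr_fun (imageProjection_mul V hB) v
  have hsymm : ⟪imageProjection V B x, B v⟫_ℝ = ⟪x, imageProjection V B (B v)⟫_ℝ := by
    conv_lhs => rw [← star_imageProjection, ContinuousLinearMap.star_eq_adjoint,
      ContinuousLinearMap.adjoint_inner_left]
  rw [ContinuousLinearMap.coe_coe, inner_sub_left, hsymm, hfix, sub_self]

theorem contDiffOn_imageProjection {F : Type*} [NormedAddCommGroup F] [NormedSpace ℝ F]
    {n : WithTop ℕ∞} (V : Submodule ℝ E) {D : F → E →L[ℝ] E} {s : Set F} (hD : ContDiffOn ℝ n D s)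
    (hinj : ∀ x ∈ s, Function.Injective (D x)) :
    ContDiffOn ℝ n (fun x => imageProjection V (D x)) s := by
  have hS : ContDiffOn ℝ n (fun x => D x * V.starProjection) s := hD.mul contDiffOn_const
  have hS' : ContDiffOn ℝ n (fun x => star (D x * V.starProjection)) s :=
    (starL' ℝ : (E →L[ℝ] E) ≃L[ℝ] (E →L[ℝ] E)).contDiff.comp_contDiffOn hS
  have hN : ContDiffOn ℝ n (fun x => gramOperator V (D x)) s :=
    (hS'.mul hS).add contDiffOn_const
  have hNinv : ContDiffOn ℝ n (fun x => Ring.inverse (gramOperator V (D x))) s := by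
    intro x hx
    obtain ⟨N, hNx⟩ := isUnit_gramOperator V (hinj x hx)
    have hinv := contDiffAt_ringInverse ℝ (n := n) N
    rw [hNx] at hinv
    exact hinv.comp_contDiffWithinAt x (hN x hx)
  exact (hS.mul hNinv).mul hS'

end ImageProjection

section Chart

variable {E : Type*} [NormedAddCommGroup E] [NormedSpace ℝ E]

theorem fderiv_symm_comp_fderiv {Φ : OpenPartialHomeomorph E E} {y : E} (hy : y ∈ Φ.source)
    {C D : E →L[ℝ] E} (hC : HasFDerivAt Φ C y) (hD : HasFDerivAt Φ.symm D (Φ y)) (z : E) :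
    D (C z) = z := by
  have hid : Φ.symm ∘ Φ =ᶠ[𝓝 y] id := by
    filter_upwards [Φ.open_source.mem_nhds hy] with z hz using Φ.left_inv hz
  exact DFunLike.congr_fun ((hD.comp y hC).unique ((hasFDerivAt_id y).congr_of_eventuallyEq hid)) z

theorem injective_fderiv_symm {Φ : OpenPartialHomeomorph E E} {y : E} (hy : y ∈ Φ.source)
    {C D : E →L[ℝ] E} (hC : HasFDerivAt Φ C y) (hD : HasFDerivAt Φ.symm D (Φ y)) :
    Function.Injective D :=
  Function.LeftInverse.injective (g := C) <|
    fderiv_symm_comp_fderiv (Φ.map_source hy) hD (by rwa [Φ.symm_symm, Φ.left_inv hy])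

theorem tangentConeAt_submodule (V : Submodule ℝ E) (hV : IsClosed (V : Set E)) {x : E}
    (hx : x ∈ V) : tangentConeAt ℝ (V : Set E) x = V := by
  refine Subset.antisymm (fun w hw => ?_) fun v hv => ?_
  · obtain ⟨ι, l, _, c, d, -, hd, hcd⟩ := exists_fun_of_mem_tangentConeAt hw
    refine hV.mem_of_tendsto hcd (hd.mono fun n hn => V.smul_mem (c n) ?_)
    exact (V.add_mem_iff_right hx).mp hn
  · simpa using mem_tangentConeAt_of_segment_subset
      (V.convex.segment_subset hx (V.add_mem hx hv))

end Chart

theorem tangentSpaceAt_eq_map {M : Set 𝔼} {Φ : OpenPartialHomeomorph 𝔼 𝔼} {V : Submodule ℝ 𝔼}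
    (hV : ∀ y ∈ Φ.source, y ∈ M ↔ Φ y ∈ V) {y : 𝔼} (hy : y ∈ Φ.source) (hyM : y ∈ M)
    {C D : 𝔼 →L[ℝ] 𝔼} (hC : HasFDerivAt Φ C y) (hD : HasFDerivAt Φ.symm D (Φ y)) :
    tangentSpaceAt M y = V.map D.toLinearMap := by
  have hcone : tangentConeAt ℝ (V : Set 𝔼) (Φ y) = V :=
    tangentConeAt_submodule V V.closed_of_finiteDimensional ((hV y hy).mp hyM)
  refine le_antisymm (Submodule.span_le.mpr fun w hw => ?_) ?_
  · rw [← tangentConeAt_inter_nhds (Φ.open_source.mem_nhds hy)] at hw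
    refine ⟨C w, ?_, fderiv_symm_comp_fderiv hy hC hD w⟩
    rw [← hcone]
    refine tangentConeAt_mono ?_ (hC.hasFDerivWithinAt.mapsTo_tangent_cone hw)
    rintro _ ⟨z, ⟨hzM, hz⟩, rfl⟩
    exact (hV z hz).mp hzM
  · rintro _ ⟨v, hv, rfl⟩
    rw [← hcone, ← tangentConeAt_inter_nhds (Φ.open_target.mem_nhds (Φ.map_source hy))] at hv
    have hDv := hD.hasFDerivWithinAt.mapsTo_tangent_cone hv
    rw [Φ.left_inv hy] at hDv
    refine Submodule.subset_span (tangentConeAt_mono ?_ hDv)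
    rintro _ ⟨z, ⟨hzV, hz⟩, rfl⟩
    rwa [hV _ (Φ.map_target hz), Φ.right_inv hz]

section Submanifold

variable {M : Set (EuclideanSpace ℝ (Fin q))} {ν : ℕ∞} {m : ℕ}

theorem IsSubmanifold.isLocallyClosed (hM : IsSubmanifold ν m M) : IsLocallyClosed M := by
  refine ((isLocallyClosed_tfae M).out 0 3).mpr fun x hx => ?_
  obtain ⟨Φ, hxΦ, -, -, V, -, hV⟩ := hM x hx
  refine ⟨Φ.source, hxΦ, Φ.open_source, fun y ⟨hyΦ, hyM⟩ => (hV y hyΦ).mpr ?_⟩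
  have hclosure : y ∈ closure (Φ.source ∩ M) := Φ.open_source.inter_closure ⟨hyΦ, hyM⟩
  refine V.closed_of_finiteDimensional.closure_subset
    ((Φ.continuousAt hyΦ).continuousWithinAt.mem_closure hclosure fun z hz => ?_)
  exact (hV z hz.1).mp hz.2

theorem IsSubmanifold.exists_contDiffOn_tangentProj (hν : 3 ≤ ν) (hM : IsSubmanifold ν m M) {x : 𝔼}
    (hx : x ∈ M) : ∃ U ∈ 𝓝 x, ∃ A : 𝔼 → 𝔼 →L[ℝ] 𝔼,
      ContDiffOn ℝ 2 A U ∧ EqOn A (tangentProj M) (M ∩ U) := by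
  obtain ⟨Φ, hxΦ, hΦ, hΦ', V, -, hV⟩ := hM x hx
  have hν' : (3 : WithTop ℕ∞) ≤ ν := WithTop.coe_le_coe.mpr hν
  replace hΦ := hΦ.of_le hν'
  replace hΦ' := hΦ'.of_le hν'
  have hC (y) (hy : y ∈ Φ.source) : HasFDerivAt Φ (fderiv ℝ Φ y) y :=
    ((hΦ.contDiffAt (Φ.open_source.mem_nhds hy)).differentiableAt (by norm_num)).hasFDerivAt
  have hD (y) (hy : y ∈ Φ.source) : HasFDerivAt Φ.symm (fderiv ℝ Φ.symm (Φ y)) (Φ y) :=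
    ((hΦ'.contDiffAt (Φ.open_target.mem_nhds (Φ.map_source hy))).differentiableAt
      (by norm_num)).hasFDerivAt
  have hinj (y) (hy : y ∈ Φ.source) : Function.Injective (fderiv ℝ Φ.symm (Φ y)) :=
    injective_fderiv_symm hy (hC y hy) (hD y hy)
  have hsmooth : ContDiffOn ℝ 2 (fun y => fderiv ℝ Φ.symm (Φ y)) Φ.source :=
    (hΦ'.fderiv_of_isOpen (m := 2) Φ.open_target (by norm_num)).comp (hΦ.of_le (by norm_num))
      fun y hy => Φ.map_source hy
  refine ⟨Φ.source, Φ.open_source.mem_nhds hxΦ,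
    fun y => imageProjection V (fderiv ℝ Φ.symm (Φ y)),
    contDiffOn_imageProjection V hsmooth hinj, fun y ⟨hyM, hy⟩ => ?_⟩
  simp only [imageProjection_eq V (hinj y hy), tangentProj,
    tangentSpaceAt_eq_map hV hy hyM (hC y hy) (hD y hy)]

theorem IsSubmanifold.exists_contDiff_eqOn_tangentProj (hν : 3 ≤ ν) (hM : IsSubmanifold ν m M)
    {K : Set 𝔼} (hK : IsCompact K) (hKM : K ⊆ M) :
    ∃ (A : 𝔼 → 𝔼 →L[ℝ] 𝔼) (U : Set 𝔼), ContDiff ℝ 2 A ∧ IsOpen U ∧ K ⊆ U ∧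
      EqOn A (tangentProj M) (M ∩ U) := by
  obtain ⟨L, hL, hKL, hLM⟩ := exists_compact_between hK hM.isLocallyClosed.isOpen_coborder
    (hKM.trans subset_coborder)
  have hML : IsClosed (M ∩ L) := by
    rw [← closure_inter_coborder (s := M), inter_assoc, inter_eq_right.mpr hLM]
    exact isClosed_closure.inter hL.isClosed
  have hconvex (x) : Convex ℝ {B | x ∈ M ∩ L → B = tangentProj M x} := by
    intro B hB B' hB' s t _ _ hst hx
    rw [hB hx, hB' hx]
    exact Convex.combo_self hst _
  obtain ⟨A, hA⟩ := exists_contMDiffMap_forall_mem_convex_of_local (n := (2 : ℕ∞))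
    (modelWithCornersSelf ℝ 𝔼) hconvex fun x => by
      by_cases hx : x ∈ M
      · obtain ⟨U, hU, A, hA, hAM⟩ := hM.exists_contDiffOn_tangentProj hν hx
        exact ⟨U, hU, A, hA.contMDiffOn, fun y hyU hy => hAM ⟨hy.1, hyU⟩⟩
      · exact ⟨(M ∩ L)ᶜ, hML.isOpen_compl.mem_nhds fun h => hx h.1, 0, contMDiffOn_const,
          fun y hy hy' => (hy hy').elim⟩
  exact ⟨A, interior L, A.contMDiff.contDiff, isOpen_interior, hKL,
    fun x hx => hA x ⟨hx.1, interior_subset hx.2⟩⟩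

end Submanifold

theorem tangentProj_apply_mem (M : Set 𝔼) (x X : 𝔼) : tangentProj M x X ∈ tangentSpaceAt M x :=
  Submodule.starProjection_apply_mem _ _

theorem tangentProj_apply_of_mem {M : Set 𝔼} {x X : 𝔼} (hX : X ∈ tangentSpaceAt M x) :
    tangentProj M x X = X :=
  Submodule.starProjection_eq_self_iff.mpr hX

theorem fderivWithin_apply_of_mem_tangentSpaceAt {F : Type*} [NormedAddCommGroup F]
    [NormedSpace ℝ F] {M : Set 𝔼} {f : 𝔼 → F} {f' : 𝔼 →L[ℝ] F} {x X : 𝔼}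
    (hf : HasFDerivWithinAt f f' M x) (hX : X ∈ tangentSpaceAt M x) :
    fderivWithin ℝ f M x X = f' X := by
  have hle : tangentSpaceAt M x ≤
      LinearMap.eqLocus (fderivWithin ℝ f M x).toLinearMap f'.toLinearMap :=
    Submodule.span_le.mpr (hf.differentiableWithinAt.hasFDerivWithinAt.unique_on hf)
  exact hle hX

/-- The expression for the curvature tensor, with a map `A` defined on all of `ℝ^q` in place of the
tangential projection. It is the curvature tensor wherever `A` extends that projection. -/
def ambientCurvature (A : 𝔼 → 𝔼 →L[ℝ] 𝔼) (x X Y Z : 𝔼) : 𝔼 :=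
  A x (fderiv ℝ A x (A x X) (fderiv ℝ A x (A x Y) (A x Z))
    - fderiv ℝ A x (A x Y) (fderiv ℝ A x (A x X) (A x Z)))

/-- The expression for the covariant derivative of the curvature tensor, with a map `A` defined on
all of `ℝ^q` in place of the tangential projection. -/
def ambientCurvatureDeriv (A : 𝔼 → 𝔼 →L[ℝ] 𝔼) (x W X Y Z : 𝔼) : 𝔼 :=
  A x (fderiv ℝ (fun y => ambientCurvature A y X Y Z) x W)

section Extension

variable {A : EuclideanSpace ℝ (Fin q) → EuclideanSpace ℝ (Fin q) →L[ℝ] EuclideanSpace ℝ (Fin q)}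

theorem contDiff_ambientCurvature (hA : ContDiff ℝ 2 A) {F : Type*} [NormedAddCommGroup F]
    [NormedSpace ℝ F] {f X Y Z : F → 𝔼} (hf : ContDiff ℝ 1 f) (hX : ContDiff ℝ 1 X)
    (hY : ContDiff ℝ 1 Y) (hZ : ContDiff ℝ 1 Z) :
    ContDiff ℝ 1 (fun p => ambientCurvature A (f p) (X p) (Y p) (Z p)) := by
  have hAf : ContDiff ℝ 1 (fun p => A (f p)) := (hA.of_le (by norm_num)).comp hf
  have hdAf : ContDiff ℝ 1 (fun p => fderiv ℝ A (f p)) := (hA.fderiv_right (by norm_num)).comp hf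
  exact hAf.clm_apply
    (((hdAf.clm_apply (hAf.clm_apply hX)).clm_apply
        ((hdAf.clm_apply (hAf.clm_apply hY)).clm_apply (hAf.clm_apply hZ))).sub
      ((hdAf.clm_apply (hAf.clm_apply hY)).clm_apply
        ((hdAf.clm_apply (hAf.clm_apply hX)).clm_apply (hAf.clm_apply hZ))))

@[fun_prop]
theorem continuous_ambientCurvature {P : Type*} [TopologicalSpace P] {f X Y Z : P → 𝔼}
    (hA : ContDiff ℝ 2 A) (hf : Continuous f) (hX : Continuous X) (hY : Continuous Y)
    (hZ : Continuous Z) : Continuous (fun p => ambientCurvature A (f p) (X p) (Y p) (Z p)) := by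
  have hR : ContDiff ℝ 1
      (fun p : 𝔼 × 𝔼 × 𝔼 × 𝔼 => ambientCurvature A p.1 p.2.1 p.2.2.1 p.2.2.2) :=
    contDiff_ambientCurvature hA (by fun_prop) (by fun_prop) (by fun_prop) (by fun_prop)
  exact hR.continuous.comp (hf.prodMk (hX.prodMk (hY.prodMk hZ)))

@[fun_prop]
theorem continuous_ambientCurvatureDeriv {P : Type*} [TopologicalSpace P] {f W X Y Z : P → 𝔼}
    (hA : ContDiff ℝ 2 A) (hf : Continuous f) (hW : Continuous W) (hX : Continuous X)
    (hY : Continuous Y) (hZ : Continuous Z) :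
    Continuous (fun p => ambientCurvatureDeriv A (f p) (W p) (X p) (Y p) (Z p)) := by
  have hfderiv : ContDiff ℝ 0 (fun p : 𝔼 × 𝔼 × 𝔼 × 𝔼 =>
      fderiv ℝ (fun y => ambientCurvature A y p.2.1 p.2.2.1 p.2.2.2) p.1) := by
    refine ContDiff.fderiv (m := 1) ?_ contDiff_fst (by norm_num)
    exact contDiff_ambientCurvature hA contDiff_snd (by fun_prop) (by fun_prop) (by fun_prop)
  exact (hA.continuous.comp hf).clm_apply
    ((hfderiv.continuous.comp (hf.prodMk (hX.prodMk (hY.prodMk hZ)))).clm_apply hW)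

variable {M : Set (EuclideanSpace ℝ (Fin q))} {x : EuclideanSpace ℝ (Fin q)}

theorem tangentProjDeriv_eq (hA : DifferentiableAt ℝ A x) (hAM : A =ᶠ[𝓝[M] x] tangentProj M)
    (hx : x ∈ M) {X : 𝔼} (hX : X ∈ tangentSpaceAt M x) :
    tangentProjDeriv M x X = fderiv ℝ A x X :=
  fderivWithin_apply_of_mem_tangentSpaceAt
    (hA.hasFDerivAt.hasFDerivWithinAt.congr_of_eventuallyEq hAM.symm
      (hAM.self_of_nhdsWithin hx).symm) hX

theorem curvature_eq (hA : DifferentiableAt ℝ A x) (hAM : A =ᶠ[𝓝[M] x] tangentProj M)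
    (hx : x ∈ M) (X Y Z : 𝔼) : curvature M x X Y Z = ambientCurvature A x X Y Z := by
  simp only [curvature, ambientCurvature, hAM.self_of_nhdsWithin hx,
    tangentProjDeriv_eq hA hAM hx (tangentProj_apply_mem M x _)]

theorem curvature_eventuallyEq (hA : Differentiable ℝ A) (hAM : A =ᶠ[𝓝[M] x] tangentProj M)
    (X Y Z : 𝔼) :
    (fun y => curvature M y X Y Z) =ᶠ[𝓝[M] x] fun y => ambientCurvature A y X Y Z := by
  filter_upwards [eventually_eventually_nhdsWithin.mpr hAM, self_mem_nhdsWithin] with y hAy hy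
    using curvature_eq (hA y) hAy hy X Y Z

theorem hasFDerivWithinAt_curvature (hA : ContDiff ℝ 2 A) (hAM : A =ᶠ[𝓝[M] x] tangentProj M)
    (hx : x ∈ M) (X Y Z : 𝔼) :
    HasFDerivWithinAt (fun y => curvature M y X Y Z)
      (fderiv ℝ (fun y => ambientCurvature A y X Y Z) x) M x := by
  have hcurv := curvature_eventuallyEq (hA.differentiable (by norm_num)) hAM X Y Z
  have hdiff : DifferentiableAt ℝ (fun y => ambientCurvature A y X Y Z) x :=
    (contDiff_ambientCurvature hA contDiff_id contDiff_const contDiff_const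
      contDiff_const).differentiable one_ne_zero x
  exact hdiff.hasFDerivAt.hasFDerivWithinAt.congr_of_eventuallyEq hcurv
    (hcurv.self_of_nhdsWithin hx)

theorem curvatureDeriv_eq (hA : ContDiff ℝ 2 A) (hAM : A =ᶠ[𝓝[M] x] tangentProj M)
    (hx : x ∈ M) {W : 𝔼} (hW : W ∈ tangentSpaceAt M x) (X Y Z : 𝔼) :
    curvatureDeriv M x W X Y Z = ambientCurvatureDeriv A x W X Y Z := by
  rw [curvatureDeriv, ambientCurvatureDeriv, hAM.self_of_nhdsWithin hx,
    fderivWithin_apply_of_mem_tangentSpaceAt (hasFDerivWithinAt_curvature hA hAM hx X Y Z) hW]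

end Extension

section Multilinearity

variable {M : Set (EuclideanSpace ℝ (Fin q))}

theorem curvature_smul (x X Y Z : 𝔼) (a b c : ℝ) :
    curvature M x (a • X) (b • Y) (c • Z) = (a * b * c) • curvature M x X Y Z := by
  simp only [curvature, tangentProjDeriv, map_smul, smul_apply, smul_smul]
  rw [show c * b * a = a * b * c by ring, show c * a * b = a * b * c by ring, ← smul_sub, map_smul]

theorem differentiableWithinAt_curvature {ν : ℕ∞} {m : ℕ} (hν : 3 ≤ ν) (hM : IsSubmanifold ν m M)
    {x : 𝔼} (hx : x ∈ M) (X Y Z : 𝔼) :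
    DifferentiableWithinAt ℝ (fun y => curvature M y X Y Z) M x := by
  obtain ⟨A, U, hA, hU, hxU, hAM⟩ := hM.exists_contDiff_eqOn_tangentProj hν
    isCompact_singleton (singleton_subset_iff.mpr hx)
  have hAx : A =ᶠ[𝓝[M] x] tangentProj M :=
    hAM.eventuallyEq_of_mem (inter_mem_nhdsWithin M (hU.mem_nhds (hxU rfl)))
  exact (hasFDerivWithinAt_curvature hA hAx hx X Y Z).differentiableWithinAt

theorem curvatureDeriv_smul {x W : 𝔼} (hW : W ∈ tangentSpaceAt M x) {X Y Z : 𝔼}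
    (hR : DifferentiableWithinAt ℝ (fun y => curvature M y X Y Z) M x) (d a b c : ℝ) :
    curvatureDeriv M x (d • W) (a • X) (b • Y) (c • Z) =
      (d * a * b * c) • curvatureDeriv M x W X Y Z := by
  simp only [curvatureDeriv, curvature_smul, map_smul]
  rw [fderivWithin_apply_of_mem_tangentSpaceAt (hR.hasFDerivWithinAt.fun_const_smul (a * b * c)) hW,
    smul_apply, map_smul, smul_smul]
  congr 1
  ring

end Multilinearity

section AbsolutelyContinuous

variable {E F : Type*} [NormedAddCommGroup E] [NormedSpace ℝ E] [NormedAddCommGroup F]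
  [NormedSpace ℝ F] {a b : ℝ}

theorem absolutelyContinuousOnInterval_of_dist_le {X Y Z : Type*} [PseudoMetricSpace X]
    [PseudoMetricSpace Y] [PseudoMetricSpace Z] {f : ℝ → X} {g : ℝ → Y} {h : ℝ → Z}
    (hg : AbsolutelyContinuousOnInterval g a b) (hh : AbsolutelyContinuousOnInterval h a b)
    {C D : ℝ} (hf : ∀ x ∈ uIcc a b, ∀ y ∈ uIcc a b,
      dist (f x) (f y) ≤ C * dist (g x) (g y) + D * dist (h x) (h y)) :
    AbsolutelyContinuousOnInterval f a b := by
  unfold AbsolutelyContinuousOnInterval at hg hh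
  refine squeeze_zero' (.of_forall fun _ => Finset.sum_nonneg fun _ _ => dist_nonneg) ?_
    (by simpa using (hg.const_mul C).add (hh.const_mul D))
  rw [eventually_inf_principal]
  filter_upwards with I hI
  simp only [Finset.mul_sum, ← Finset.sum_add_distrib]
  exact Finset.sum_le_sum fun i hi => hf _ (hI.1 i hi).1 _ (hI.1 i hi).2

theorem absolutelyContinuousOnInterval_congr {X : Type*} [PseudoMetricSpace X] {f g : ℝ → X}
    (hf : AbsolutelyContinuousOnInterval f a b) (hfg : EqOn g f (uIcc a b)) :
    AbsolutelyContinuousOnInterval g a b :=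
  absolutelyContinuousOnInterval_of_dist_le (C := 1) (D := 0) hf hf fun x hx y hy => by
    simp [hfg hx, hfg hy]

theorem absolutelyContinuousOnInterval_intervalIntegral {k : ℝ → E}
    (hk : IntervalIntegrable k volume a b) :
    AbsolutelyContinuousOnInterval (fun t => ∫ s in a..t, k s) a b := by
  have hk_sub : ∀ {x}, x ∈ uIcc a b → IntervalIntegrable k volume a x :=
    fun hx => hk.mono_set (uIcc_subset_uIcc left_mem_uIcc hx)
  have hnorm := hk.norm.absolutelyContinuousOnInterval_intervalIntegral left_mem_uIcc
  refine absolutelyContinuousOnInterval_of_dist_le (C := 1) (D := 0) hnorm hnorm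
    fun x hx y hy => ?_
  rw [one_mul, zero_mul, add_zero, dist_eq_norm, dist_eq_norm,
    intervalIntegral.integral_interval_sub_left (hk_sub hx) (hk_sub hy),
    intervalIntegral.integral_interval_sub_left (hk_sub hx).norm (hk_sub hy).norm]
  exact intervalIntegral.norm_integral_le_abs_integral_norm

theorem absolutelyContinuousOnInterval_clm_apply {L : ℝ → E →L[ℝ] F} {f : ℝ → E}
    (hL : AbsolutelyContinuousOnInterval L a b) (hf : AbsolutelyContinuousOnInterval f a b) :
    AbsolutelyContinuousOnInterval (fun t => L t (f t)) a b := by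
  obtain ⟨C, hC⟩ := hL.exists_bound
  obtain ⟨D, hD⟩ := hf.exists_bound
  refine absolutelyContinuousOnInterval_of_dist_le (C := C) (D := D) hf hL fun x hx y hy => ?_
  refine (dist_triangle _ (L x (f y)) _).trans (add_le_add ?_ ?_)
  · rw [dist_eq_norm, dist_eq_norm, ← map_sub]
    exact (L x).le_of_opNorm_le (hC x hx) _
  · rw [dist_eq_norm, dist_eq_norm, ← sub_apply, mul_comm]
    exact (L x - L y).le_opNorm_of_le (hD y hy)

theorem eq_add_integral_of_ae_hasDerivAt [CompleteSpace E] {f k : ℝ → E} (hab : a ≤ b)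
    (hf : AbsolutelyContinuousOnInterval f a b) (hk : IntervalIntegrable k volume a b)
    (hderiv : ∀ᵐ t ∂volume.restrict (Ioc a b), HasDerivAt f (k t) t) :
    ∀ t ∈ Icc a b, f t = f a + ∫ s in a..t, k s := by
  have hsub : ∀ᵐ t, t ∈ uIcc a b → HasDerivAt (fun t => f t - ∫ s in a..t, k s) 0 t := by
    rw [restrict_Ioc_eq_restrict_Icc, ae_restrict_iff' measurableSet_Icc, ← uIcc_of_le hab]
      at hderiv
    filter_upwards [hderiv, hk.ae_hasDerivAt_integral] with t hft hkt ht
    simpa only [sub_self] using (hft ht).fun_sub (hkt ht a left_mem_uIcc)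
  obtain ⟨C, hC⟩ :=
    (hf.sub (absolutelyContinuousOnInterval_intervalIntegral hk)).const_of_ae_hasDerivAt_zero
      hsub
  intro t ht
  rw [uIcc_of_le hab] at hC
  have hCt := hC t ht
  have hCa := hC a (left_mem_Icc.mpr hab)
  simp only [Pi.sub_apply, intervalIntegral.integral_same, sub_zero] at hCt hCa
  rw [hCa, ← hCt, sub_add_cancel]

theorem ae_hasDerivAt_of_eq_add_integral [CompleteSpace E] {f g : ℝ → E}
    (hg : IntervalIntegrable g volume a b) (hfg : ∀ t ∈ Icc a b, f t = f a + ∫ s in a..t, g s) :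
    ∀ᵐ t ∂volume.restrict (Ioc a b), HasDerivAt f (g t) t := by
  rw [← restrict_Ioo_eq_restrict_Ioc, ae_restrict_iff' measurableSet_Ioo]
  filter_upwards [hg.ae_hasDerivAt_integral] with t hint ht
  have ht_mem : t ∈ uIcc a b := Icc_subset_uIcc (Ioo_subset_Icc_self ht)
  refine ((hint ht_mem a left_mem_uIcc).const_add (f a)).congr_of_eventuallyEq ?_
  filter_upwards [Ioo_mem_nhds ht.1 ht.2] with s hs using hfg s (Ioo_subset_Icc_self hs)

end AbsolutelyContinuous

/-- Lebesgue measure on a fundamental domain of the circle `ℝ / 2πℤ`. -/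
abbrev circleMeasure : Measure ℝ := volume.restrict (Ioc 0 (2 * π))

section CircleMeasure

variable {E F : Type*} [NormedAddCommGroup E] [NormedAddCommGroup F]

theorem memLp_circleMeasure_of_continuous [SecondCountableTopologyEither ℝ F] {f : ℝ → F}
    (hf : Continuous f) (p : ENNReal) : MemLp f p circleMeasure := by
  obtain ⟨C, hC⟩ := (isCompact_Icc (a := (0 : ℝ)) (b := 2 * π)).exists_bound_of_continuousOn
    hf.continuousOn
  refine MemLp.of_bound hf.aestronglyMeasurable C ?_
  filter_upwards [ae_restrict_mem measurableSet_Ioc] with t ht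
  exact hC t (Ioc_subset_Icc_self ht)

theorem memLp_circleMeasure_clm_apply [NormedSpace ℝ E] [NormedSpace ℝ F] {L : ℝ → E →L[ℝ] F}
    (hL : Continuous L) {k : ℝ → E} {p : ENNReal} (hk : MemLp k p circleMeasure) :
    MemLp (fun t => L t (k t)) p circleMeasure := by
  obtain ⟨C, hC⟩ := (isCompact_Icc (a := (0 : ℝ)) (b := 2 * π)).exists_bound_of_continuousOn
    hL.continuousOn
  refine hk.of_le_mul (c := C) ?_ ?_
  · exact (isBoundedBilinearMap_apply (𝕜 := ℝ) (E := E) (F := F)).continuous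
      |>.comp_aestronglyMeasurable (hL.aestronglyMeasurable.prodMk hk.1)
  · filter_upwards [ae_restrict_mem measurableSet_Ioc] with t ht
    exact (L t).le_of_opNorm_le (hC t (Ioc_subset_Icc_self ht)) _

theorem intervalIntegrable_of_memLp_circleMeasure {f : ℝ → F} (hf : MemLp f 2 circleMeasure) :
    IntervalIntegrable f volume 0 (2 * π) := by
  rw [intervalIntegrable_iff_integrableOn_Ioc_of_le (by positivity)]
  exact hf.integrable one_le_two

end CircleMeasure

theorem IsW22.differentiable {f : ℝ → 𝔼} (hf : IsW22 f) : Differentiable ℝ f :=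
  hf.contDiff.differentiable one_ne_zero

theorem IsW22.continuous {f : ℝ → 𝔼} (hf : IsW22 f) : Continuous f :=
  hf.contDiff.continuous

theorem IsW22.continuous_deriv {f : ℝ → 𝔼} (hf : IsW22 f) : Continuous (deriv f) :=
  hf.contDiff.continuous_deriv le_rfl

theorem IsW22.ae_hasDerivAt_deriv {f : ℝ → 𝔼} (hf : IsW22 f) :
    ∀ᵐ t ∂circleMeasure, HasDerivAt (deriv f) (deriv (deriv f) t) t := by
  obtain ⟨g, hg, hfg⟩ := hf.exists_second_deriv
  filter_upwards [ae_hasDerivAt_of_eq_add_integral (intervalIntegrable_of_memLp_circleMeasure hg)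
    hfg] with t ht using ht.differentiableAt.hasDerivAt

theorem IsW22.memLp_deriv_deriv {f : ℝ → 𝔼} (hf : IsW22 f) :
    MemLp (deriv (deriv f)) 2 circleMeasure := by
  obtain ⟨g, hg, hfg⟩ := hf.exists_second_deriv
  refine hg.ae_eq ?_
  filter_upwards [ae_hasDerivAt_of_eq_add_integral (intervalIntegrable_of_memLp_circleMeasure hg)
    hfg] with t ht using ht.deriv.symm

theorem IsW22.absolutelyContinuousOnInterval_deriv {f : ℝ → 𝔼} (hf : IsW22 f) :
    AbsolutelyContinuousOnInterval (deriv f) 0 (2 * π) := by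
  obtain ⟨g, hg, hfg⟩ := hf.exists_second_deriv
  have hconst : AbsolutelyContinuousOnInterval (fun _ => deriv f 0) 0 (2 * π) :=
    contDiffOn_const.absolutelyContinuousOnInterval
  refine absolutelyContinuousOnInterval_congr
    (hconst.fun_add (absolutelyContinuousOnInterval_intervalIntegral
      (intervalIntegrable_of_memLp_circleMeasure hg))) ?_
  rw [uIcc_of_le (by positivity)]
  exact hfg

theorem isW22_of_ae_hasDerivAt {f g : ℝ → 𝔼} (hper : Function.Periodic f (2 * π))
    (hf : ContDiff ℝ 1 f) (hac : AbsolutelyContinuousOnInterval (deriv f) 0 (2 * π))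
    (hg : MemLp g 2 circleMeasure) (hfg : ∀ᵐ t ∂circleMeasure, HasDerivAt (deriv f) (g t) t) :
    IsW22 f :=
  ⟨hper, hf, g, hg, eq_add_integral_of_ae_hasDerivAt (by positivity) hac
    (intervalIntegrable_of_memLp_circleMeasure hg) hfg⟩

section Product

variable {A : EuclideanSpace ℝ (Fin q) → EuclideanSpace ℝ (Fin q) →L[ℝ] EuclideanSpace ℝ (Fin q)}
  {u v : ℝ → EuclideanSpace ℝ (Fin q)}

theorem hasDerivAt_clm_comp_apply {t : ℝ} {u' v' : 𝔼} (hA : DifferentiableAt ℝ A (u t))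
    (hu : HasDerivAt u u' t) (hv : HasDerivAt v v' t) :
    HasDerivAt (fun s => A (u s) (v s)) (fderiv ℝ A (u t) u' (v t) + A (u t) v') t :=
  (hA.hasFDerivAt.comp_hasDerivAt t hu).clm_apply hv

theorem IsW22.clm_comp_apply (hA : ContDiff ℝ 2 A) (hu : IsW22 u) (hv : IsW22 v) :
    IsW22 (fun t => A (u t) (v t)) := by
  set L : ℝ → 𝔼 →L[ℝ] 𝔼 := fun t => A (u t)
  set N : ℝ → 𝔼 →L[ℝ] 𝔼 := fun t => (fderiv ℝ A (u t)).flip (v t)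
  have hL : ContDiff ℝ 1 L := (hA.of_le (by norm_num)).comp hu.contDiff
  have hN : ContDiff ℝ 1 N := by
    have hdA : ContDiff ℝ 1 (fun t => fderiv ℝ A (u t)) :=
      (hA.fderiv_right (by norm_num)).comp hu.contDiff
    exact ((ContinuousLinearMap.flipₗᵢ ℝ 𝔼 𝔼 𝔼).contDiff.comp hdA).clm_apply hv.contDiff
  have hderiv : deriv (fun t => A (u t) (v t)) = fun t => N t (deriv u t) + L t (deriv v t) :=
    funext fun t => (hasDerivAt_clm_comp_apply (hA.differentiable (by norm_num) _)
      (hu.differentiable t).hasDerivAt (hv.differentiable t).hasDerivAt).deriv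
  have hmemLp : ∀ {P : ℝ → 𝔼 →L[ℝ] 𝔼} {w : ℝ → 𝔼}, ContDiff ℝ 1 P → IsW22 w →
      MemLp (fun t => deriv P t (deriv w t) + P t (deriv (deriv w) t)) 2 circleMeasure :=
    fun hP hw => (memLp_circleMeasure_of_continuous
        ((hP.continuous_deriv le_rfl).clm_apply hw.continuous_deriv) 2).add
      (memLp_circleMeasure_clm_apply hP.continuous hw.memLp_deriv_deriv)
  refine isW22_of_ae_hasDerivAt (fun t => by simp only [hu.periodic t, hv.periodic t])
    (hL.clm_apply hv.contDiff) ?_ ((hmemLp hN hu).add (hmemLp hL hv)) ?_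
  · rw [hderiv]
    exact (absolutelyContinuousOnInterval_clm_apply
        hN.contDiffOn.absolutelyContinuousOnInterval hu.absolutelyContinuousOnInterval_deriv).add
      (absolutelyContinuousOnInterval_clm_apply
        hL.contDiffOn.absolutelyContinuousOnInterval hv.absolutelyContinuousOnInterval_deriv)
  · rw [hderiv]
    filter_upwards [hu.ae_hasDerivAt_deriv, hv.ae_hasDerivAt_deriv] with t hut hvt
    exact ((hN.differentiable one_ne_zero t).hasDerivAt.clm_apply hut).add
      ((hL.differentiable one_ne_zero t).hasDerivAt.clm_apply hvt)

end Product

theorem IsImmersion.deriv_mem_tangentSpaceAt {M : Set 𝔼} {u : ℝ → 𝔼} (hu : IsImmersion M u)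
    (t : ℝ) : deriv u t ∈ tangentSpaceAt M (u t) := by
  have hmaps := ((hu.isW22.differentiable t).hasDerivAt.hasFDerivAt.hasFDerivWithinAt
    (s := univ)).mapsTo_tangent_cone
  have hcone := hmaps (by rw [tangentConeAt_univ]; exact mem_univ (1 : ℝ))
  simp only [ContinuousLinearMap.toSpanSingleton_apply, one_smul, image_univ] at hcone
  exact Submodule.subset_span (tangentConeAt_mono (range_subset_iff.mpr hu.mem) hcone)

theorem exists_norm_le_of_homogeneous {P Z G : Type*} [NormedAddCommGroup P] [ProperSpace P]
    [NormedAddCommGroup Z] [NormedSpace ℝ Z] [ProperSpace Z] [NormedAddCommGroup G]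
    [NormedSpace ℝ G] {f : P → Z → G} (hf : Continuous (fun x : P × Z => f x.1 x.2)) (k : ℕ)
    (hhom : ∀ p (c : ℝ) z, f p (c • z) = c ^ k • f p z) (r : ℝ) :
    ∃ C, 0 ≤ C ∧ ∀ p z, ‖p‖ ≤ r → ‖f p z‖ ≤ C * ‖z‖ ^ k := by
  obtain ⟨C, hC⟩ := ((isCompact_closedBall (0 : P) r).prod
    (isCompact_closedBall (0 : Z) 1)).exists_bound_of_continuousOn hf.continuousOn
  refine ⟨max C 0, le_max_right _ _, fun p z hp => ?_⟩
  have hunit : ‖‖z‖⁻¹ • z‖ ≤ 1 := by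
    rw [norm_smul, norm_inv, norm_norm]
    exact inv_mul_le_one
  have hz : ‖z‖ • ‖z‖⁻¹ • z = z := by
    rcases eq_or_ne z 0 with rfl | hz
    · simp
    · exact smul_inv_smul₀ (norm_ne_zero_iff.mpr hz) z
  calc ‖f p z‖ = ‖z‖ ^ k * ‖f p (‖z‖⁻¹ • z)‖ := by
        rw [← norm_norm z, ← norm_pow, ← norm_smul, norm_norm, ← hhom, hz]
    _ ≤ ‖z‖ ^ k * max C 0 := by
        gcongr
        exact (hC (p, ‖z‖⁻¹ • z) (by simp [hp, hunit])).trans (le_max_left _ _)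
    _ = max C 0 * ‖z‖ ^ k := mul_comm _ _

theorem exists_norm_le_of_continuous {P G : Type*} [NormedAddCommGroup P] [ProperSpace P]
    [NormedAddCommGroup G] {f : P → G} (hf : Continuous f) (r : ℝ) :
    ∃ C, ∀ p, ‖p‖ ≤ r → ‖f p‖ ≤ C := by
  obtain ⟨C, hC⟩ := (isCompact_closedBall (0 : P) r).exists_bound_of_continuousOn hf.continuousOn
  exact ⟨C, fun p hp => hC p (by simpa using hp)⟩

/-- The data `(u, u̇, |u̇|⁻¹, v, v̇)` on which the second variation of length depends. The inverse
speed is included because it must be bounded too. -/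
def firstJet (u v : ℝ → 𝔼) (t : ℝ) : 𝔼 × 𝔼 × ℝ × 𝔼 × 𝔼 :=
  (u t, deriv u t, ‖deriv u t‖⁻¹, v t, deriv v t)

/-- The data `(1, K, v̈)` in which the integrand of the second variation of `E_σ` is quadratic; the
entry `1` makes the lower order terms homogeneous. -/
def secondJet (M : Set 𝔼) (u v : ℝ → 𝔼) (t : ℝ) : ℝ × 𝔼 × 𝔼 :=
  (1, curvatureVector M u t, deriv (deriv v) t)

/-- The integrand, with respect to arc length, of the second variation of length as a function of
`firstJet u v t`. -/
def lengthForm (A : 𝔼 → 𝔼 →L[ℝ] 𝔼) : 𝔼 × 𝔼 × ℝ × 𝔼 × 𝔼 → ℝ := fun (x, ξ, ρ, V, V') =>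
  ‖ρ • A x V'‖ ^ 2 - ⟪ρ • A x V', ρ • ξ⟫_ℝ ^ 2 - ⟪ambientCurvature A x (ρ • ξ) V V, ρ • ξ⟫_ℝ

/-- `D_t D_t v` as a function of `firstJet u v t` and `secondJet M u v t`. -/
def secondCovDerivForm (A : 𝔼 → 𝔼 →L[ℝ] 𝔼) :
    𝔼 × 𝔼 × ℝ × 𝔼 × 𝔼 → ℝ × 𝔼 × 𝔼 → 𝔼 := fun (x, ξ, ρ, _, V') (s, _, V'') =>
  ρ • ρ • A x (s • fderiv ℝ A x ξ V' + A x V'')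

/-- `curvatureSecondVariation M u v t` as a function of `firstJet u v t` and, quadratically,
`secondJet M u v t`. -/
def curvatureForm (A : 𝔼 → 𝔼 →L[ℝ] 𝔼) (p : 𝔼 × 𝔼 × ℝ × 𝔼 × 𝔼) (z : ℝ × 𝔼 × 𝔼) : ℝ :=
  let (x, ξ, ρ, V, V') := p
  let (s, K, _) := z
  let T := ρ • ξ
  let DV := ρ • A x V'
  let DDV := secondCovDerivForm A p z
  let R := ambientCurvature A x
  let DR := ambientCurvatureDeriv A x
  ‖DDV‖ ^ 2 + s ^ 2 * ‖R V T T‖ ^ 2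
    + 2 * (4 * ⟪DV, T⟫_ℝ ^ 2 + 2 * ⟪DV, T⟫_ℝ ^ 2 - ‖DV‖ ^ 2 + ⟪R T V V, T⟫_ℝ) * ‖K‖ ^ 2
    - (⟪DDV, T⟫_ℝ + ⟪DV, K⟫_ℝ) ^ 2 - 8 * ⟪DV, T⟫_ℝ * ⟪DDV, K⟫_ℝ
    + s * ⟪DR T V T V, K⟫_ℝ + s * ⟪DR V V T T, K⟫_ℝ
    + s * ⟪R DV T V, K⟫_ℝ - ⟪R K V V, K⟫_ℝ + 3 * (s * ⟪R V T DV, K⟫_ℝ) + s * ⟪R V DV T, K⟫_ℝ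
    + 2 * (s * ⟪R V T T, DDV⟫_ℝ) - 8 * ⟪DV, T⟫_ℝ * (s * ⟪R V T T, K⟫_ℝ)

/-- The integrand of the second summand of `secondVariation`, without the factor `4 σ²`, as a
function of `firstJet u v t` and, quadratically, `secondJet M u v t`. -/
def mixedForm (A : 𝔼 → 𝔼 →L[ℝ] 𝔼) (p : 𝔼 × 𝔼 × ℝ × 𝔼 × 𝔼) (z : ℝ × 𝔼 × 𝔼) : ℝ :=
  let (x, ξ, ρ, V, V') := p
  let (s, K, _) := z
  let T := ρ • ξ
  let DV := ρ • A x V'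
  ⟪DV, T⟫_ℝ * (⟪secondCovDerivForm A p z, K⟫_ℝ - 2 * ⟪DV, T⟫_ℝ * ‖K‖ ^ 2
    + s * ⟪ambientCurvature A x V T T, K⟫_ℝ)

section Forms

variable {A : EuclideanSpace ℝ (Fin q) → EuclideanSpace ℝ (Fin q) →L[ℝ] EuclideanSpace ℝ (Fin q)}

theorem continuous_lengthForm (hA : ContDiff ℝ 2 A) : Continuous (lengthForm A) := by
  have hA₀ : Continuous A := hA.continuous
  unfold lengthForm
  fun_prop

@[fun_prop]
theorem continuous_secondCovDerivForm {P : Type*} [TopologicalSpace P]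
    {p : P → 𝔼 × 𝔼 × ℝ × 𝔼 × 𝔼} {z : P → ℝ × 𝔼 × 𝔼} (hA : ContDiff ℝ 2 A) (hp : Continuous p)
    (hz : Continuous z) : Continuous (fun a => secondCovDerivForm A (p a) (z a)) := by
  have hA₀ : Continuous A := hA.continuous
  have hA₁ : Continuous (fderiv ℝ A) := hA.continuous_fderiv (by norm_num)
  unfold secondCovDerivForm
  fun_prop

theorem continuous_curvatureForm (hA : ContDiff ℝ 2 A) :
    Continuous (fun a : (𝔼 × 𝔼 × ℝ × 𝔼 × 𝔼) × ℝ × 𝔼 × 𝔼 => curvatureForm A a.1 a.2) := by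
  have hA₀ : Continuous A := hA.continuous
  simp only [curvatureForm]
  fun_prop

theorem continuous_mixedForm (hA : ContDiff ℝ 2 A) :
    Continuous (fun a : (𝔼 × 𝔼 × ℝ × 𝔼 × 𝔼) × ℝ × 𝔼 × 𝔼 => mixedForm A a.1 a.2) := by
  have hA₀ : Continuous A := hA.continuous
  unfold mixedForm
  fun_prop

theorem secondCovDerivForm_smul (p : 𝔼 × 𝔼 × ℝ × 𝔼 × 𝔼) (c : ℝ) (z : ℝ × 𝔼 × 𝔼) :
    secondCovDerivForm A p (c • z) = c • secondCovDerivForm A p z := by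
  simp only [secondCovDerivForm, Prod.smul_fst, Prod.smul_snd, smul_eq_mul, mul_smul, map_smul,
    ← smul_add, smul_comm _ c]

theorem ambientCurvature_smul_left (x X Y Z : 𝔼) (c : ℝ) :
    ambientCurvature A x (c • X) Y Z = c • ambientCurvature A x X Y Z := by
  simp only [ambientCurvature, map_smul, smul_apply, ← smul_sub]

theorem curvatureForm_smul (p : 𝔼 × 𝔼 × ℝ × 𝔼 × 𝔼) (c : ℝ) (z : ℝ × 𝔼 × 𝔼) :
    curvatureForm A p (c • z) = c ^ 2 • curvatureForm A p z := by
  simp only [curvatureForm, secondCovDerivForm_smul, Prod.smul_fst, Prod.smul_snd, smul_eq_mul,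
    ambientCurvature_smul_left, real_inner_smul_left, real_inner_smul_right, norm_smul, mul_pow,
    Real.norm_eq_abs, sq_abs]
  ring

theorem mixedForm_smul (p : 𝔼 × 𝔼 × ℝ × 𝔼 × 𝔼) (c : ℝ) (z : ℝ × 𝔼 × 𝔼) :
    mixedForm A p (c • z) = c ^ 2 • mixedForm A p z := by
  simp only [mixedForm, secondCovDerivForm_smul, Prod.smul_fst, Prod.smul_snd, smul_eq_mul,
    real_inner_smul_left, real_inner_smul_right, norm_smul, mul_pow, Real.norm_eq_abs, sq_abs]
  ring

end Forms

/-- `u` is a constant speed immersion into `M`, and `A` extends the tangential projection of `M`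
near every point of `u`. -/
structure IsAdapted (M : Set 𝔼) (A : 𝔼 → 𝔼 →L[ℝ] 𝔼) (u : ℝ → 𝔼) : Prop where
  isImmersion : IsImmersion M u
  constSpeed : ∀ s t, ‖deriv u s‖ = ‖deriv u t‖
  eventuallyEq : ∀ t, A =ᶠ[𝓝[M] u t] tangentProj M

/-- The integral of an upper bound for `‖secondJet M u v‖ ^ 2`. It controls the integral of every
function which is quadratic in `secondJet M u v`. -/
def jetEnergy (M : Set 𝔼) (u v : ℝ → 𝔼) : ℝ :=
  ∫ t in (0 : ℝ)..(2 * π), (1 + geodesicCurvature M u t ^ 2 + ‖deriv (deriv v) t‖ ^ 2)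

theorem norm_secondJet_sq_le (M : Set 𝔼) (u v : ℝ → 𝔼) (t : ℝ) :
    ‖secondJet M u v t‖ ^ 2 ≤ 1 + geodesicCurvature M u t ^ 2 + ‖deriv (deriv v) t‖ ^ 2 := by
  have hsq : ∀ a b : ℝ, max a b ^ 2 ≤ a ^ 2 + b ^ 2 := fun a b => by
    rcases max_cases a b with ⟨h, -⟩ | ⟨h, -⟩ <;> rw [h] <;> nlinarith [sq_nonneg a, sq_nonneg b]
  calc ‖secondJet M u v t‖ ^ 2
      ≤ ‖(1 : ℝ)‖ ^ 2 + max ‖curvatureVector M u t‖ ‖deriv (deriv v) t‖ ^ 2 := hsq _ _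
    _ ≤ 1 + (geodesicCurvature M u t ^ 2 + ‖deriv (deriv v) t‖ ^ 2) := by
        rw [norm_one, one_pow]
        gcongr
        exact hsq _ _
    _ = _ := (add_assoc _ _ _).symm

section Adapted

variable {M : Set (EuclideanSpace ℝ (Fin q))}
  {A : EuclideanSpace ℝ (Fin q) → EuclideanSpace ℝ (Fin q) →L[ℝ] EuclideanSpace ℝ (Fin q)}
  {u v : ℝ → EuclideanSpace ℝ (Fin q)}

theorem covDeriv_eq {t : ℝ} (hAM : A =ᶠ[𝓝[M] u t] tangentProj M) (ht : u t ∈ M) (w : ℝ → 𝔼) :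
    covDeriv M u w t = ‖deriv u t‖⁻¹ • A (u t) (deriv w t) := by
  rw [covDeriv, hAM.self_of_nhdsWithin ht]

theorem IsAdapted.covDeriv_eq (hu : IsAdapted M A u) (w : ℝ → 𝔼) (t : ℝ) :
    covDeriv M u w t = ‖deriv u t‖⁻¹ • A (u t) (deriv w t) :=
  ViscosityGeodesic.covDeriv_eq (hu.eventuallyEq t) (hu.isImmersion.mem t) w

theorem IsAdapted.apply_deriv (hu : IsAdapted M A u) (t : ℝ) :
    A (u t) (deriv u t) = deriv u t := by
  rw [(hu.eventuallyEq t).self_of_nhdsWithin (hu.isImmersion.mem t),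
    tangentProj_apply_of_mem (hu.isImmersion.deriv_mem_tangentSpaceAt t)]

theorem IsAdapted.curvatureVector_eq (hu : IsAdapted M A u) (t : ℝ) :
    curvatureVector M u t =
      ‖deriv u t‖⁻¹ • ‖deriv u t‖⁻¹ • A (u t) (deriv (deriv u) t) := by
  have hT : unitTangent u = ‖deriv u t‖⁻¹ • deriv u :=
    funext fun s => by rw [unitTangent, hu.constSpeed s t, Pi.smul_apply]
  rw [curvatureVector, hu.covDeriv_eq, hT, deriv_const_smul_field, map_smul]

theorem IsAdapted.memLp_curvatureVector (hA : Continuous A) (hu : IsAdapted M A u) :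
    MemLp (curvatureVector M u) 2 circleMeasure := by
  have hK : curvatureVector M u = (‖deriv u 0‖⁻¹ * ‖deriv u 0‖⁻¹) •
      fun t => A (u t) (deriv (deriv u) t) := funext fun t => by
    rw [hu.curvatureVector_eq, hu.constSpeed t 0, Pi.smul_apply, mul_smul]
  rw [hK]
  exact (memLp_circleMeasure_clm_apply (hA.comp hu.isImmersion.isW22.continuous)
    hu.isImmersion.isW22.memLp_deriv_deriv).const_smul _

theorem IsAdapted.integrable_geodesicCurvature_sq (hA : Continuous A) (hu : IsAdapted M A u) :
    Integrable (fun t => geodesicCurvature M u t ^ 2) circleMeasure :=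
  (hu.memLp_curvatureVector hA).integrable_norm_pow two_ne_zero

theorem IsAdapted.integrable_jetEnergy (hA : Continuous A) (hu : IsAdapted M A u)
    (hv : IsW22 v) : Integrable
      (fun t => 1 + geodesicCurvature M u t ^ 2 + ‖deriv (deriv v) t‖ ^ 2) circleMeasure :=
  ((integrable_const 1).add (hu.integrable_geodesicCurvature_sq hA)).add
    (hv.memLp_deriv_deriv.integrable_norm_pow two_ne_zero)

theorem IsAdapted.ae_covDeriv_covDeriv_eq (hA : Differentiable ℝ A) (hu : IsAdapted M A u)
    (hv : IsW22 v) : ∀ᵐ t ∂circleMeasure, covDeriv M u (covDeriv M u v) t =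
      secondCovDerivForm A (firstJet u v t) (secondJet M u v t) := by
  filter_upwards [hv.ae_hasDerivAt_deriv] with t hvt
  have hDv : covDeriv M u v = fun s => ‖deriv u t‖⁻¹ • A (u s) (deriv v s) :=
    funext fun s => by rw [hu.covDeriv_eq, hu.constSpeed s t]
  have hderiv := (hasDerivAt_clm_comp_apply (hA (u t))
    (hu.isImmersion.isW22.differentiable t).hasDerivAt hvt).fun_const_smul ‖deriv u t‖⁻¹
  rw [hu.covDeriv_eq, hDv, hderiv.deriv, map_smul]
  simp only [secondCovDerivForm, firstJet, secondJet, one_smul]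

theorem IsAdapted.ae_curvatureSecondVariation_eq (hA : ContDiff ℝ 2 A) (hu : IsAdapted M A u)
    (hv : v ∈ fieldsAlong M u) : ∀ᵐ t ∂circleMeasure, curvatureSecondVariation M u v t =
      curvatureForm A (firstJet u v t) (secondJet M u v t) := by
  have hA₁ : Differentiable ℝ A := hA.differentiable (by norm_num)
  filter_upwards [hu.ae_covDeriv_covDeriv_eq hA₁ hv.1] with t hDDv
  have hR := curvature_eq (hA₁ (u t)) (hu.eventuallyEq t) (hu.isImmersion.mem t)
  have hT : unitTangent u t ∈ tangentSpaceAt M (u t) :=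
    Submodule.smul_mem _ _ (hu.isImmersion.deriv_mem_tangentSpaceAt t)
  have hDR {W : 𝔼} (hW : W ∈ tangentSpaceAt M (u t)) :=
    curvatureDeriv_eq hA (hu.eventuallyEq t) (hu.isImmersion.mem t) hW
  simp only [curvatureSecondVariation, hDDv, hu.covDeriv_eq v, hR, hDR hT, hDR (hv.2 t)]
  simp only [curvatureForm, firstJet, secondJet, unitTangent, one_mul, one_pow]

theorem IsAdapted.ae_mixed_eq (hA : Differentiable ℝ A) (hu : IsAdapted M A u)
    (hv : IsW22 v) : ∀ᵐ t ∂circleMeasure,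
      ⟪covDeriv M u v t, unitTangent u t⟫_ℝ *
          (⟪covDeriv M u (covDeriv M u v) t, curvatureVector M u t⟫_ℝ
            - 2 * ⟪covDeriv M u v t, unitTangent u t⟫_ℝ * geodesicCurvature M u t ^ 2
            + ⟪curvature M (u t) (v t) (unitTangent u t) (unitTangent u t),
                curvatureVector M u t⟫_ℝ) =
        mixedForm A (firstJet u v t) (secondJet M u v t) := by
  filter_upwards [hu.ae_covDeriv_covDeriv_eq hA hv] with t hDDv
  simp only [hDDv, hu.covDeriv_eq v, geodesicCurvature, unitTangent,
    curvature_eq (hA (u t)) (hu.eventuallyEq t) (hu.isImmersion.mem t)]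
  simp only [mixedForm, firstJet, secondJet, one_mul]

theorem lengthForm_firstJet {t : ℝ} (hA : DifferentiableAt ℝ A (u t))
    (hAM : A =ᶠ[𝓝[M] u t] tangentProj M) (ht : u t ∈ M) (v : ℝ → 𝔼) :
    lengthForm A (firstJet u v t) =
      ‖covDeriv M u v t‖ ^ 2 - ⟪covDeriv M u v t, unitTangent u t⟫_ℝ ^ 2
        - ⟪curvature M (u t) (unitTangent u t) (v t) (v t), unitTangent u t⟫_ℝ := by
  simp only [covDeriv_eq hAM ht, unitTangent, curvature_eq hA hAM ht, lengthForm, firstJet]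

end Adapted

theorem intervalIntegral_eq_integral_circleMeasure {F : Type*} [NormedAddCommGroup F]
    [NormedSpace ℝ F] (f : ℝ → F) :
    ∫ t in (0 : ℝ)..(2 * π), f t = ∫ t, f t ∂circleMeasure :=
  intervalIntegral.integral_of_le (by positivity)

section Estimates

variable {A : EuclideanSpace ℝ (Fin q) → EuclideanSpace ℝ (Fin q) →L[ℝ] EuclideanSpace ℝ (Fin q)}

theorem exists_abs_integral_form_le (M : Set 𝔼) (hA : Continuous A)
    {Q : 𝔼 × 𝔼 × ℝ × 𝔼 × 𝔼 → ℝ × 𝔼 × 𝔼 → ℝ}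
    (hQ : Continuous (fun a : (𝔼 × 𝔼 × ℝ × 𝔼 × 𝔼) × ℝ × 𝔼 × 𝔼 => Q a.1 a.2))
    (hQ₂ : ∀ p (c : ℝ) z, Q p (c • z) = c ^ 2 • Q p z) (r : ℝ) :
    ∃ C, 0 ≤ C ∧ ∀ u v, IsAdapted M A u → IsW22 v → (∀ t, ‖firstJet u v t‖ ≤ r) →
      |∫ t, Q (firstJet u v t) (secondJet M u v t) * ‖deriv u t‖ ∂circleMeasure|
        ≤ C * jetEnergy M u v := by
  obtain ⟨C, hC₀, hC⟩ := exists_norm_le_of_homogeneous (f := fun p z => Q p z * ‖p.2.1‖)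
    (by fun_prop) 2 (fun p c z => by rw [hQ₂, smul_mul_assoc]) r
  refine ⟨C, hC₀, fun u v hu hv hr => ?_⟩
  rw [jetEnergy, intervalIntegral_eq_integral_circleMeasure, ← integral_const_mul]
  refine norm_integral_le_of_norm_le ((hu.integrable_jetEnergy hA hv).const_mul C)
    (.of_forall fun t => (hC _ (secondJet M u v t) (hr t)).trans ?_)
  gcongr
  exact norm_secondJet_sq_le M u v t

variable {M : Set (EuclideanSpace ℝ (Fin q))} {u v : ℝ → EuclideanSpace ℝ (Fin q)}

theorem IsImmersion.continuous_firstJet (hu : IsImmersion M u) (hv : IsW22 v) :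
    Continuous (firstJet u v) := by
  have hu' : Continuous (fun t => ‖deriv u t‖⁻¹) :=
    hu.isW22.continuous_deriv.norm.inv₀ fun t => norm_ne_zero_iff.mpr (hu.deriv_ne_zero t)
  exact hu.isW22.continuous.prodMk (hu.isW22.continuous_deriv.prodMk
    (hu'.prodMk (hv.continuous.prodMk hv.continuous_deriv)))

theorem IsImmersion.continuous_lengthForm_mul (hA : ContDiff ℝ 2 A) (hu : IsImmersion M u)
    (hv : IsW22 v) : Continuous (fun t => lengthForm A (firstJet u v t) * ‖deriv u t‖) :=
  ((continuous_lengthForm hA).comp (hu.continuous_firstJet hv)).mul hu.isW22.continuous_deriv.norm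

theorem secondVariation_zero_eq (hA : Differentiable ℝ A) (hu : IsImmersion M u)
    (hAM : ∀ t, A =ᶠ[𝓝[M] u t] tangentProj M) (v : ℝ → 𝔼) :
    secondVariation M 0 u v =
      ∫ t, lengthForm A (firstJet u v t) * ‖deriv u t‖ ∂circleMeasure := by
  simp only [lengthForm_firstJet (hA _) (hAM _) (hu.mem _), secondVariation,
    intervalIntegral_eq_integral_circleMeasure, ne_eq, OfNat.ofNat_ne_zero, not_false_eq_true,
    zero_pow, mul_zero, zero_mul, add_zero, zero_add, one_mul]

theorem IsAdapted.secondVariation_eq (hA : ContDiff ℝ 2 A) (hu : IsAdapted M A u)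
    (hv : v ∈ fieldsAlong M u) (σ : ℝ) :
    secondVariation M σ u v = secondVariation M 0 u v + σ ^ 2 *
      (2 * (∫ t, curvatureForm A (firstJet u v t) (secondJet M u v t) * ‖deriv u t‖ ∂circleMeasure)
        + 4 * (∫ t, mixedForm A (firstJet u v t) (secondJet M u v t) * ‖deriv u t‖ ∂circleMeasure)
        + ∫ t, ‖(secondJet M u v t).2.1‖ ^ 2 * lengthForm A (firstJet u v t) * ‖deriv u t‖
            ∂circleMeasure) := by
  have hA₁ : Differentiable ℝ A := hA.differentiable (by norm_num)
  have hlength := hu.isImmersion.continuous_lengthForm_mul hA hv.1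
  have hcurvature := integral_congr_ae ((hu.ae_curvatureSecondVariation_eq hA hv).mono
    fun t ht => congrArg (· * ‖deriv u t‖) ht)
  have hmixed := integral_congr_ae ((hu.ae_mixed_eq hA₁ hv.1).mono
    fun t ht => congrArg (· * ‖deriv u t‖) ht)
  have hint : Integrable (fun t => geodesicCurvature M u t ^ 2 *
      (lengthForm A (firstJet u v t) * ‖deriv u t‖)) circleMeasure :=
    (hu.integrable_geodesicCurvature_sq hA.continuous).mul_of_top_left
      (memLp_circleMeasure_of_continuous hlength ⊤)
  have hsum : ∫ t, (1 + σ ^ 2 * geodesicCurvature M u t ^ 2) *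
      lengthForm A (firstJet u v t) * ‖deriv u t‖ ∂circleMeasure =
      (∫ t, lengthForm A (firstJet u v t) * ‖deriv u t‖ ∂circleMeasure) +
        σ ^ 2 * ∫ t, geodesicCurvature M u t ^ 2 *
          (lengthForm A (firstJet u v t) * ‖deriv u t‖) ∂circleMeasure := by
    rw [← integral_const_mul, ← integral_add
      ((memLp_circleMeasure_of_continuous hlength 1).integrable le_rfl) (hint.const_mul _)]
    congr with t
    ring
  rw [secondVariation_zero_eq hA₁ hu.isImmersion hu.eventuallyEq]
  simp only [secondVariation, intervalIntegral_eq_integral_circleMeasure, ← hcurvature, ← hmixed,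
    ← lengthForm_firstJet (hA₁ _) (hu.eventuallyEq _) (hu.isImmersion.mem _), hsum]
  simp only [secondJet, geodesicCurvature, mul_assoc]
  ring

theorem exists_abs_secondVariation_sub_le (M : Set 𝔼) (hA : ContDiff ℝ 2 A) (r : ℝ) :
    ∃ C, 0 ≤ C ∧ ∀ σ u v, IsAdapted M A u → v ∈ fieldsAlong M u →
      (∀ t, ‖firstJet u v t‖ ≤ r) →
        |secondVariation M σ u v - secondVariation M 0 u v| ≤ C * (σ ^ 2 * jetEnergy M u v) := by
  have hlength := continuous_lengthForm hA
  obtain ⟨C₁, hC₁, hcurvature⟩ := exists_abs_integral_form_le M hA.continuous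
    (continuous_curvatureForm hA) curvatureForm_smul r
  obtain ⟨C₂, hC₂, hmixed⟩ := exists_abs_integral_form_le M hA.continuous
    (continuous_mixedForm hA) mixedForm_smul r
  obtain ⟨C₃, hC₃, hlower⟩ := exists_abs_integral_form_le M hA.continuous
    (Q := fun p z => ‖z.2.1‖ ^ 2 * lengthForm A p) (by fun_prop)
    (fun p c z => by simp [norm_smul, mul_pow, mul_assoc]) r
  refine ⟨2 * C₁ + 4 * C₂ + C₃, by positivity, fun σ u v hu hv hr => ?_⟩
  rw [hu.secondVariation_eq hA hv, add_sub_cancel_left, abs_mul, abs_of_nonneg (sq_nonneg σ),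
    mul_left_comm]
  gcongr
  refine (abs_add_three _ _ _).trans ?_
  rw [abs_mul, abs_mul, abs_two, abs_of_pos (by norm_num : (0 : ℝ) < 4)]
  linarith [hcurvature u v hu hv.1 hr, hmixed u v hu hv.1 hr, hlower u v hu hv.1 hr]

end Estimates

/-- The field `A(u) v` along `u`. Where `A` extends the tangential projection, this is the
projection of `v` to a tangent field along `u`. -/
def projField (A : 𝔼 → 𝔼 →L[ℝ] 𝔼) (u v : ℝ → 𝔼) (t : ℝ) : 𝔼 :=
  A (u t) (v t)

/-- The derivative of `projField A u v` at `t` as a function of `(u t, u̇ t, v t, v̇ t)`. -/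
def projDeriv (A : 𝔼 → 𝔼 →L[ℝ] 𝔼) : 𝔼 × 𝔼 × 𝔼 × 𝔼 → 𝔼 := fun (x, ξ, V, V') =>
  fderiv ℝ A x ξ V + A x V'

/-- `firstJet u (projField A u v) t` as a function of `firstJet u v t`. -/
def projFirstJet (A : 𝔼 → 𝔼 →L[ℝ] 𝔼) : 𝔼 × 𝔼 × ℝ × 𝔼 × 𝔼 → 𝔼 × 𝔼 × ℝ × 𝔼 × 𝔼 :=
  fun (x, ξ, ρ, V, V') => (x, ξ, ρ, A x V, projDeriv A (x, ξ, V, V'))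

/-- The second derivative of `projField A u v` as a function of `firstJet u v t` and, linearly,
`secondJet M u v t`. Since `A(u) u̇ = u̇`, the second derivative of `u` is
`DA(u)(u̇) u̇ + |u̇|² K`. -/
def projSecondDerivForm (A : 𝔼 → 𝔼 →L[ℝ] 𝔼) : 𝔼 × 𝔼 × ℝ × 𝔼 × 𝔼 → ℝ × 𝔼 × 𝔼 → 𝔼 :=
  fun (x, ξ, _, V, V') (s, K, V'') => fderiv ℝ (projDeriv A) (x, ξ, V, V')
    (s • ξ, s • fderiv ℝ A x ξ ξ + ‖ξ‖ ^ 2 • K, s • V', V'')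

section Projection

variable {M : Set (EuclideanSpace ℝ (Fin q))}
  {A : EuclideanSpace ℝ (Fin q) → EuclideanSpace ℝ (Fin q) →L[ℝ] EuclideanSpace ℝ (Fin q)}
  {u v : ℝ → EuclideanSpace ℝ (Fin q)}

theorem contDiff_projDeriv (hA : ContDiff ℝ 2 A) : ContDiff ℝ 1 (projDeriv A) := by
  have hA₀ : ContDiff ℝ 1 A := hA.of_le (by norm_num)
  unfold projDeriv
  fun_prop

theorem continuous_projFirstJet (hA : ContDiff ℝ 2 A) : Continuous (projFirstJet A) := by
  have hA₀ : Continuous A := hA.continuous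
  have hA₁ : Continuous (projDeriv A) := (contDiff_projDeriv hA).continuous
  unfold projFirstJet
  fun_prop

theorem continuous_projSecondDerivForm (hA : ContDiff ℝ 2 A) : Continuous
    (fun a : (𝔼 × 𝔼 × ℝ × 𝔼 × 𝔼) × ℝ × 𝔼 × 𝔼 => projSecondDerivForm A a.1 a.2) := by
  have hA₁ : Continuous (fderiv ℝ A) := hA.continuous_fderiv (by norm_num)
  have hA₂ : Continuous (fderiv ℝ (projDeriv A)) :=
    (contDiff_projDeriv hA).continuous_fderiv one_ne_zero
  unfold projSecondDerivForm
  fun_prop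

theorem projSecondDerivForm_smul (p : 𝔼 × 𝔼 × ℝ × 𝔼 × 𝔼) (c : ℝ) (z : ℝ × 𝔼 × 𝔼) :
    projSecondDerivForm A p (c • z) = c • projSecondDerivForm A p z := by
  simp only [projSecondDerivForm, Prod.smul_fst, Prod.smul_snd, smul_eq_mul, mul_smul,
    smul_comm _ c, ← smul_add, ← Prod.smul_mk, map_smul]

theorem hasDerivAt_projField (hA : Differentiable ℝ A) (hu : IsW22 u) (hv : IsW22 v) (t : ℝ) :
    HasDerivAt (projField A u v) (projDeriv A (u t, deriv u t, v t, deriv v t)) t :=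
  hasDerivAt_clm_comp_apply (hA _) (hu.differentiable t).hasDerivAt
    (hv.differentiable t).hasDerivAt

theorem firstJet_projField (hA : Differentiable ℝ A) (hu : IsW22 u) (hv : IsW22 v) (t : ℝ) :
    firstJet u (projField A u v) t = projFirstJet A (firstJet u v t) := by
  simp only [firstJet, (hasDerivAt_projField hA hu hv t).deriv, projFirstJet, projField]

theorem IsAdapted.projField_mem_fieldsAlong (hA : ContDiff ℝ 2 A) (hu : IsAdapted M A u)
    (hv : IsW22 v) : projField A u v ∈ fieldsAlong M u := by
  refine ⟨hu.isImmersion.isW22.clm_comp_apply hA hv, fun t => ?_⟩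
  rw [projField, (hu.eventuallyEq t).self_of_nhdsWithin (hu.isImmersion.mem t)]
  exact tangentProj_apply_mem M _ _

theorem IsAdapted.ae_deriv_deriv_eq (hA : Differentiable ℝ A) (hu : IsAdapted M A u) :
    ∀ᵐ t ∂circleMeasure, deriv (deriv u) t =
      fderiv ℝ A (u t) (deriv u t) (deriv u t) + ‖deriv u t‖ ^ 2 • curvatureVector M u t := by
  filter_upwards [hu.isImmersion.isW22.ae_hasDerivAt_deriv] with t ht
  have hprod := hasDerivAt_clm_comp_apply (hA (u t))
    (hu.isImmersion.isW22.differentiable t).hasDerivAt ht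
  have hspeed : ‖deriv u t‖ ≠ 0 := norm_ne_zero_iff.mpr (hu.isImmersion.deriv_ne_zero t)
  simp only [hu.apply_deriv] at hprod
  rw [hu.curvatureVector_eq, sq, mul_smul, smul_inv_smul₀ hspeed, smul_inv_smul₀ hspeed]
  exact ht.unique hprod

theorem IsAdapted.ae_deriv_deriv_projField_eq (hA : ContDiff ℝ 2 A) (hu : IsAdapted M A u)
    (hv : IsW22 v) : ∀ᵐ t ∂circleMeasure, deriv (deriv (projField A u v)) t =
      projSecondDerivForm A (firstJet u v t) (secondJet M u v t) := by
  have hA₁ : Differentiable ℝ A := hA.differentiable (by norm_num)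
  have hu₂ : IsW22 u := hu.isImmersion.isW22
  have hderiv : deriv (projField A u v) =
      fun t => projDeriv A (u t, deriv u t, v t, deriv v t) :=
    funext fun t => (hasDerivAt_projField hA₁ hu₂ hv t).deriv
  filter_upwards [hu.ae_deriv_deriv_eq hA₁, hu₂.ae_hasDerivAt_deriv, hv.ae_hasDerivAt_deriv]
    with t hu'' hut hvt
  have hcurve : HasDerivAt (fun t => (u t, deriv u t, v t, deriv v t))
      (deriv u t, deriv (deriv u) t, deriv v t, deriv (deriv v) t) t :=
    (hu₂.differentiable t).hasDerivAt.prodMk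
      (hut.prodMk ((hv.differentiable t).hasDerivAt.prodMk hvt))
  have hproj := ((contDiff_projDeriv hA).differentiable one_ne_zero _).hasFDerivAt.comp_hasDerivAt
    t hcurve
  rw [hderiv]
  refine hproj.deriv.trans ?_
  simp only [projSecondDerivForm, firstJet, secondJet, one_smul, hu'']

theorem exists_norm_firstJet_projField_le (hA : ContDiff ℝ 2 A) (r : ℝ) :
    ∃ C, ∀ u v t, IsW22 u → IsW22 v → ‖firstJet u v t‖ ≤ r →
      ‖firstJet u (projField A u v) t‖ ≤ C := by
  obtain ⟨C, hC⟩ := exists_norm_le_of_continuous (continuous_projFirstJet hA) r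
  refine ⟨C, fun u v t hu hv hr => ?_⟩
  rw [firstJet_projField (hA.differentiable (by norm_num)) hu hv]
  exact hC _ hr

theorem exists_jetEnergy_projField_le (M : Set 𝔼) (hA : ContDiff ℝ 2 A) (r : ℝ) :
    ∃ C, 0 ≤ C ∧ ∀ u v, IsAdapted M A u → IsW22 v → (∀ t, ‖firstJet u v t‖ ≤ r) →
      jetEnergy M u (projField A u v) ≤ C * jetEnergy M u v := by
  obtain ⟨C, -, hC⟩ := exists_norm_le_of_homogeneous (continuous_projSecondDerivForm hA) 1
    (fun p c z => by rw [pow_one, projSecondDerivForm_smul]) r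
  refine ⟨1 + C ^ 2, by positivity, fun u v hu hv hr => ?_⟩
  simp only [jetEnergy, intervalIntegral_eq_integral_circleMeasure, ← integral_const_mul]
  refine integral_mono_ae (hu.integrable_jetEnergy hA.continuous
    (hu.projField_mem_fieldsAlong hA hv).1)
    ((hu.integrable_jetEnergy hA.continuous hv).const_mul _) ?_
  filter_upwards [hu.ae_deriv_deriv_projField_eq hA hv] with t ht
  have hsq : ‖deriv (deriv (projField A u v)) t‖ ^ 2 ≤ C ^ 2 * ‖secondJet M u v t‖ ^ 2 := by
    rw [ht, ← mul_pow]
    gcongr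
    simpa only [pow_one] using hC _ (secondJet M u v t) (hr t)
  nlinarith [norm_secondJet_sq_le M u v t, sq_nonneg C, sq_nonneg ‖deriv (deriv v) t‖]

theorem exists_abs_secondVariation_projField_sub_le (M : Set 𝔼) (hA : ContDiff ℝ 2 A) (r : ℝ) :
    ∃ C, ∀ σ u v, IsAdapted M A u → IsW22 v → (∀ t, ‖firstJet u v t‖ ≤ r) →
      |secondVariation M σ u (projField A u v) - secondVariation M 0 u (projField A u v)| ≤
        C * (σ ^ 2 * jetEnergy M u v) := by
  obtain ⟨r', hr'⟩ := exists_norm_firstJet_projField_le hA r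
  obtain ⟨C, hC₀, hC⟩ := exists_abs_secondVariation_sub_le M hA r'
  obtain ⟨D, -, hD⟩ := exists_jetEnergy_projField_le M hA r
  refine ⟨C * D, fun σ u v hu hv hr => ?_⟩
  calc |secondVariation M σ u (projField A u v) - secondVariation M 0 u (projField A u v)|
      ≤ C * (σ ^ 2 * jetEnergy M u (projField A u v)) :=
        hC σ u _ hu (hu.projField_mem_fieldsAlong hA hv)
          fun t => hr' u v t hu.isImmersion.isW22 hv (hr t)
    _ ≤ C * (σ ^ 2 * (D * jetEnergy M u v)) := by
        gcongr
        exact hD u v hu hv hr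
    _ = C * D * (σ ^ 2 * jetEnergy M u v) := by ring

end Projection

section Convergence

variable {M : Set (EuclideanSpace ℝ (Fin q))}
  {A : EuclideanSpace ℝ (Fin q) → EuclideanSpace ℝ (Fin q) →L[ℝ] EuclideanSpace ℝ (Fin q)}

theorem projField_eq_self {u v : ℝ → 𝔼} (hu : ∀ t, u t ∈ M)
    (hAM : ∀ t, A =ᶠ[𝓝[M] u t] tangentProj M) (hv : v ∈ fieldsAlong M u) :
    projField A u v = v :=
  funext fun t => by
    rw [projField, (hAM t).self_of_nhdsWithin (hu t), tangentProj_apply_of_mem (hv.2 t)]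

theorem secondVariation_zero_projField (hA : Differentiable ℝ A) {u v : ℝ → 𝔼}
    (hu : IsImmersion M u) (hAM : ∀ t, A =ᶠ[𝓝[M] u t] tangentProj M) (hv : IsW22 v) :
    secondVariation M 0 u (projField A u v) = ∫ t,
      lengthForm A (projFirstJet A (firstJet u v t)) * ‖(firstJet u v t).2.1‖ ∂circleMeasure := by
  simp only [secondVariation_zero_eq hA hu hAM, firstJet_projField hA hu.isW22 hv]
  rfl

theorem tendsto_integral_of_tendsto_firstJet {ι : Type*} {l : Filter ι} [l.IsCountablyGenerated]
    {G : 𝔼 × 𝔼 × ℝ × 𝔼 × 𝔼 → ℝ} (hG : Continuous G) {u v : ι → ℝ → 𝔼} {u₀ v₀ : ℝ → 𝔼} {r : ℝ}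
    (hu : ∀ᶠ i in l, IsImmersion M (u i)) (hv : ∀ i, IsW22 (v i))
    (hr : ∀ᶠ i in l, ∀ t, ‖firstJet (u i) (v i) t‖ ≤ r)
    (hlim : ∀ᵐ t, Tendsto (fun i => firstJet (u i) (v i) t) l (𝓝 (firstJet u₀ v₀ t))) :
    Tendsto (fun i => ∫ t, G (firstJet (u i) (v i) t) ∂circleMeasure) l
      (𝓝 (∫ t, G (firstJet u₀ v₀ t) ∂circleMeasure)) := by
  obtain ⟨C, hC⟩ := exists_norm_le_of_continuous hG r
  refine tendsto_integral_filter_of_dominated_convergence (fun _ => C) ?_ ?_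
    (integrable_const C) ?_
  · filter_upwards [hu] with i hui
    exact (hG.comp (hui.continuous_firstJet (hv i))).aestronglyMeasurable
  · filter_upwards [hr] with i hri using .of_forall fun t => hC _ (hri t)
  · filter_upwards [ae_restrict_of_ae hlim] with t ht using (hG.tendsto _).comp ht

theorem tendsto_secondVariation_projField {ι : Type*} {l : Filter ι} [l.IsCountablyGenerated]
    (hA : ContDiff ℝ 2 A) {σ : ι → ℝ} {u v : ι → ℝ → 𝔼} {u₀ v₀ : ℝ → 𝔼} {r : ℝ}
    (hu : ∀ᶠ i in l, IsAdapted M A (u i)) (hv : ∀ i, IsW22 (v i))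
    (hr : ∀ᶠ i in l, ∀ t, ‖firstJet (u i) (v i) t‖ ≤ r)
    (hlim : ∀ᵐ t, Tendsto (fun i => firstJet (u i) (v i) t) l (𝓝 (firstJet u₀ v₀ t)))
    (henergy : Tendsto (fun i => σ i ^ 2 * jetEnergy M (u i) (v i)) l (𝓝 0))
    (hu₀ : IsImmersion M u₀) (hAM : ∀ t, A =ᶠ[𝓝[M] u₀ t] tangentProj M)
    (hv₀ : v₀ ∈ fieldsAlong M u₀) :
    Tendsto (fun i => secondVariation M (σ i) (u i) (projField A (u i) (v i))) l
      (𝓝 (secondVariation M 0 u₀ v₀)) := by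
  have hA₁ : Differentiable ℝ A := hA.differentiable (by norm_num)
  have hlength : Continuous fun p : 𝔼 × 𝔼 × ℝ × 𝔼 × 𝔼 =>
      lengthForm A (projFirstJet A p) * ‖p.2.1‖ :=
    ((continuous_lengthForm hA).comp (continuous_projFirstJet hA)).mul (by fun_prop)
  have hzero : Tendsto (fun i => secondVariation M 0 (u i) (projField A (u i) (v i))) l
      (𝓝 (secondVariation M 0 u₀ v₀)) := by
    rw [← projField_eq_self hu₀.mem hAM hv₀, secondVariation_zero_projField hA₁ hu₀ hAM hv₀.1]
    refine (tendsto_integral_of_tendsto_firstJet hlength (hu.mono fun i hi => hi.isImmersion) hv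
      hr hlim).congr' ?_
    filter_upwards [hu] with i hi
    exact (secondVariation_zero_projField hA₁ hi.isImmersion hi.eventuallyEq (hv i)).symm
  obtain ⟨C, hC⟩ := exists_abs_secondVariation_projField_sub_le M hA r
  have hdiff : Tendsto (fun i => secondVariation M (σ i) (u i) (projField A (u i) (v i)) -
      secondVariation M 0 (u i) (projField A (u i) (v i))) l (𝓝 0) := by
    refine squeeze_zero_norm' ?_ (by simpa using henergy.const_mul C)
    filter_upwards [hu, hr] with i hui hri using hC (σ i) (u i) (v i) hui (hv i) hri
  simpa using hdiff.add hzero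

end Convergence

section LinearFamily

variable {ι : Type*} [Fintype ι] {e : ι → ℝ → EuclideanSpace ℝ (Fin q)}

theorem norm_linearCombination_le {E : Type*} [SeminormedAddCommGroup E] [NormedSpace ℝ E]
    (f : ι → E) (c : ι → ℝ) : ‖Fintype.linearCombination ℝ f c‖ ≤ ‖c‖ * ∑ i, ‖f i‖ := by
  rw [Fintype.linearCombination_apply, Finset.mul_sum]
  refine norm_sum_le_of_le _ fun i _ => ?_
  rw [norm_smul]
  gcongr
  exact norm_le_pi_norm c i

theorem linearCombination_fun_apply {X E : Type*} [AddCommGroup E] [Module ℝ E] (f : ι → X → E)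
    (c : ι → ℝ) (x : X) :
    Fintype.linearCombination ℝ f c x = Fintype.linearCombination ℝ (fun i => f i x) c := by
  simp only [Fintype.linearCombination_apply, Finset.sum_apply, Pi.smul_apply]

theorem hasDerivAt_linearCombination {E : Type*} [NormedAddCommGroup E] [NormedSpace ℝ E]
    {f f' : ι → ℝ → E} {t : ℝ} (hf : ∀ i, HasDerivAt (f i) (f' i t) t) (c : ι → ℝ) :
    HasDerivAt (Fintype.linearCombination ℝ f c) (Fintype.linearCombination ℝ f' c t) t := by
  simp only [linearCombination_fun_apply f', Fintype.linearCombination_apply]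
  exact HasDerivAt.sum fun i _ => (hf i).const_smul (c i)

theorem IsW22.linearCombination (he : ∀ i, IsW22 (e i)) (c : ι → ℝ) :
    IsW22 (Fintype.linearCombination ℝ e c) := by
  rw [Fintype.linearCombination_apply]
  exact Finset.sum_induction _ IsW22 (fun _ _ => IsW22.add) IsW22.zero
    fun i _ => (he i).smul (c i)

theorem IsW22.deriv_linearCombination (he : ∀ i, IsW22 (e i)) (c : ι → ℝ) :
    deriv (Fintype.linearCombination ℝ e c) =
      Fintype.linearCombination ℝ (fun i => deriv (e i)) c :=
  funext fun t => (hasDerivAt_linearCombination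
    (fun i => ((he i).differentiable t).hasDerivAt) c).deriv

theorem IsW22.exists_norm_le {f : ℝ → 𝔼} (hf : IsW22 f) :
    ∃ C, ∀ t, ‖f t‖ ≤ C ∧ ‖deriv f t‖ ≤ C := by
  have hderiv : Function.Periodic (deriv f) (2 * π) := fun t => by
    rw [← deriv_comp_add_const, hf.periodic.funext]
  have hbdd {g : ℝ → 𝔼} (hper : Function.Periodic g (2 * π)) (hg : Continuous g) :
      ∃ C, ∀ t, ‖g t‖ ≤ C := by
    simpa using (hper.compact_of_continuous Real.two_pi_pos.ne' hg).isBounded.exists_norm_le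
  obtain ⟨C, hC⟩ := hbdd hf.periodic hf.continuous
  obtain ⟨D, hD⟩ := hbdd hderiv hf.continuous_deriv
  exact ⟨max C D, fun t => ⟨(hC t).trans (le_max_left _ _), (hD t).trans (le_max_right _ _)⟩⟩

theorem exists_norm_linearCombination_le (he : ∀ i, IsW22 (e i)) : ∃ B, ∀ (c : ι → ℝ) t,
    ‖Fintype.linearCombination ℝ e c t‖ ≤ ‖c‖ * B ∧
      ‖deriv (Fintype.linearCombination ℝ e c) t‖ ≤ ‖c‖ * B := by
  choose C hC using fun i => (he i).exists_norm_le
  refine ⟨∑ i, C i, fun c t => ⟨?_, ?_⟩⟩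
  · rw [linearCombination_fun_apply]
    refine (norm_linearCombination_le _ c).trans ?_
    gcongr with i
    exact (hC i t).1
  · rw [IsW22.deriv_linearCombination he, linearCombination_fun_apply]
    refine (norm_linearCombination_le _ c).trans ?_
    gcongr with i
    exact (hC i t).2

theorem exists_integral_deriv_deriv_linearCombination_le (he : ∀ i, IsW22 (e i)) :
    ∃ D, ∀ c : ι → ℝ,
      ∫ t, ‖deriv (deriv (Fintype.linearCombination ℝ e c)) t‖ ^ 2 ∂circleMeasure ≤
        ‖c‖ ^ 2 * D := by
  have hint : Integrable (fun t => (∑ i, ‖deriv (deriv (e i)) t‖) ^ 2) circleMeasure :=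
    (memLp_finsetSum Finset.univ fun i _ => (he i).memLp_deriv_deriv.norm).integrable_sq
  refine ⟨∫ t, (∑ i, ‖deriv (deriv (e i)) t‖) ^ 2 ∂circleMeasure, fun c => ?_⟩
  rw [← integral_const_mul]
  refine integral_mono_ae
    ((IsW22.linearCombination he c).memLp_deriv_deriv.integrable_norm_pow two_ne_zero)
    (hint.const_mul _) ?_
  filter_upwards [ae_all_iff.mpr fun i => (he i).ae_hasDerivAt_deriv] with t ht
  rw [IsW22.deriv_linearCombination he, (hasDerivAt_linearCombination ht c).deriv,
    linearCombination_fun_apply, ← mul_pow]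
  gcongr
  exact norm_linearCombination_le _ c

end LinearFamily

section Sequence

variable {M : Set (EuclideanSpace ℝ (Fin q))}
  {A : EuclideanSpace ℝ (Fin q) → EuclideanSpace ℝ (Fin q) →L[ℝ] EuclideanSpace ℝ (Fin q)}
  {σ : ℕ → ℝ} {u : ℕ → ℝ → EuclideanSpace ℝ (Fin q)} {u₀ : ℝ → EuclideanSpace ℝ (Fin q)}

theorem eventually_isAdapted {U : Set 𝔼} (hU : IsOpen U) (hu₀ : IsW22 u₀) (hu₀U : ∀ t, u₀ t ∈ U)
    (hAM : EqOn A (tangentProj M) (M ∩ U)) (hu : ∀ n, IsImmersion M (u n))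
    (hspeed : ∀ n s t, ‖deriv (u n) s‖ = ‖deriv (u n) t‖) (hunif : TendstoUniformly u u₀ atTop) :
    ∀ᶠ n in atTop, IsAdapted M A (u n) := by
  have hcompact : IsCompact (range u₀) :=
    hu₀.periodic.compact_of_continuous Real.two_pi_pos.ne' hu₀.continuous
  obtain ⟨δ, hδ, hδU⟩ := hcompact.exists_thickening_subset_open hU (range_subset_iff.mpr hu₀U)
  filter_upwards [Metric.tendstoUniformly_iff.mp hunif δ hδ] with n hn
  refine ⟨hu n, hspeed n, fun t => hAM.eventuallyEq_of_mem
    (inter_mem_nhdsWithin M (hU.mem_nhds (hδU ?_)))⟩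
  exact Metric.mem_thickening_iff.mpr ⟨u₀ t, mem_range_self t, by rw [dist_comm]; exact hn t⟩

theorem exists_tendsto_speed (hu₀ : ∀ t, deriv u₀ t ≠ 0)
    (hspeed : ∀ n s t, ‖deriv (u n) s‖ = ‖deriv (u n) t‖)
    (hderiv : ∀ᵐ t, Tendsto (fun n => deriv (u n) t) atTop (𝓝 (deriv u₀ t))) :
    ∃ ℓ, ℓ ≠ 0 ∧ ∀ t, Tendsto (fun n => ‖deriv (u n) t‖) atTop (𝓝 ℓ) := by
  obtain ⟨t₀, ht₀⟩ := hderiv.exists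
  refine ⟨‖deriv u₀ t₀‖, norm_ne_zero_iff.mpr (hu₀ t₀), fun t => ?_⟩
  simpa only [hspeed _ t t₀] using ht₀.norm

theorem tendsto_sq_mul_integral_geodesicCurvature_sq (hu : ∀ n, IsImmersion M (u n))
    (hspeed : ∀ n s t, ‖deriv (u n) s‖ = ‖deriv (u n) t‖)
    (hentropy : Tendsto (fun n => σ n ^ 2 *
      ∫ t in (0 : ℝ)..(2 * π), geodesicCurvature M (u n) t ^ 2 * ‖deriv (u n) t‖) atTop (𝓝 0))
    {ℓ : ℝ} (hℓ : ℓ ≠ 0) (hlim : Tendsto (fun n => ‖deriv (u n) 0‖) atTop (𝓝 ℓ)) :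
    Tendsto (fun n => σ n ^ 2 * ∫ t, geodesicCurvature M (u n) t ^ 2 ∂circleMeasure) atTop
      (𝓝 0) := by
  have hprod := hentropy.mul (hlim.inv₀ hℓ)
  rw [zero_mul] at hprod
  refine hprod.congr fun n => ?_
  have hne : ‖deriv (u n) 0‖ ≠ 0 := norm_ne_zero_iff.mpr ((hu n).deriv_ne_zero 0)
  simp only [hspeed n _ 0, intervalIntegral_eq_integral_circleMeasure, integral_mul_const]
  rw [← mul_assoc, mul_inv_cancel_right₀ hne]

theorem IsAdapted.jetEnergy_eq {γ v : ℝ → 𝔼} (hA : Continuous A) (hγ : IsAdapted M A γ)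
    (hv : IsW22 v) : jetEnergy M γ v = 2 * π + (∫ t, geodesicCurvature M γ t ^ 2 ∂circleMeasure) +
      ∫ t, ‖deriv (deriv v) t‖ ^ 2 ∂circleMeasure := by
  have hκ := hγ.integrable_geodesicCurvature_sq hA
  have hone_add : Integrable (fun t => 1 + geodesicCurvature M γ t ^ 2) circleMeasure :=
    (integrable_const 1).add hκ
  rw [jetEnergy, intervalIntegral_eq_integral_circleMeasure,
    integral_add hone_add (hv.memLp_deriv_deriv.integrable_norm_pow two_ne_zero),
    integral_add (integrable_const 1) hκ]
  simp [Real.two_pi_pos.le]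

theorem tendsto_sq_mul_jetEnergy {ι : Type*} [Fintype ι] (hA : Continuous A)
    (hadapted : ∀ᶠ n in atTop, IsAdapted M A (u n)) (hσ : Tendsto σ atTop (𝓝 0))
    (hκ : Tendsto (fun n => σ n ^ 2 * ∫ t, geodesicCurvature M (u n) t ^ 2 ∂circleMeasure) atTop
      (𝓝 0)) {e : ι → ℝ → 𝔼} (he : ∀ i, IsW22 (e i)) (c₀ : ι → ℝ) :
    Tendsto (fun p : ℕ × (ι → ℝ) => σ p.1 ^ 2 *
      jetEnergy M (u p.1) (Fintype.linearCombination ℝ e p.2)) (atTop ×ˢ 𝓝 c₀) (𝓝 0) := by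
  obtain ⟨D, hD⟩ := exists_integral_deriv_deriv_linearCombination_le he
  have hσ₂ : Tendsto (fun p : ℕ × (ι → ℝ) => σ p.1 ^ 2) (atTop ×ˢ 𝓝 c₀) (𝓝 0) := by
    simpa using (hσ.comp tendsto_fst).pow 2
  have hc : Tendsto (fun p : ℕ × (ι → ℝ) => ‖p.2‖ ^ 2 * D) (atTop ×ˢ 𝓝 c₀)
      (𝓝 (‖c₀‖ ^ 2 * D)) :=
    (tendsto_snd.norm.pow 2).mul_const D
  have hbound : Tendsto (fun p : ℕ × (ι → ℝ) => σ p.1 ^ 2 * (2 * π) +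
      σ p.1 ^ 2 * (∫ t, geodesicCurvature M (u p.1) t ^ 2 ∂circleMeasure) +
      σ p.1 ^ 2 * (‖p.2‖ ^ 2 * D)) (atTop ×ˢ 𝓝 c₀) (𝓝 0) := by
    simpa using ((hσ₂.mul_const (2 * π)).add (hκ.comp tendsto_fst)).add (hσ₂.mul hc)
  refine squeeze_zero' (.of_forall fun p => ?_) ?_ hbound
  · exact mul_nonneg (sq_nonneg _) (intervalIntegral.integral_nonneg (by positivity)
      fun t _ => by positivity)
  · filter_upwards [tendsto_fst.eventually hadapted] with p hp
    rw [hp.jetEnergy_eq hA (IsW22.linearCombination he p.2), mul_add, mul_add]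
    gcongr
    exact hD p.2

theorem exists_eventually_norm_firstJet_le {ι : Type*} [Fintype ι] (hu₀ : IsW22 u₀)
    (hspeed : ∀ n s t, ‖deriv (u n) s‖ = ‖deriv (u n) t‖) (hunif : TendstoUniformly u u₀ atTop)
    {ℓ : ℝ} (hℓ : ℓ ≠ 0) (hlim : Tendsto (fun n => ‖deriv (u n) 0‖) atTop (𝓝 ℓ))
    {e : ι → ℝ → 𝔼} (he : ∀ i, IsW22 (e i)) (c₀ : ι → ℝ) :
    ∃ r, ∀ᶠ p : ℕ × (ι → ℝ) in atTop ×ˢ 𝓝 c₀, ∀ t,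
      ‖firstJet (u p.1) (Fintype.linearCombination ℝ e p.2) t‖ ≤ r := by
  obtain ⟨a, ha⟩ := hu₀.exists_norm_le
  obtain ⟨B, hB⟩ := exists_norm_linearCombination_le he
  have hcurve : ∀ᶠ n in atTop, ∀ t, ‖u n t‖ ≤ a + 1 := by
    filter_upwards [Metric.tendstoUniformly_iff.mp hunif 1 one_pos] with n hn t
    have hdist := (hn t).le
    rw [dist_eq_norm'] at hdist
    exact (norm_le_norm_add_norm_sub' _ _).trans (add_le_add (ha t).1 hdist)
  obtain ⟨b, hb⟩ := hlim.isBoundedUnder_le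
  obtain ⟨b', hb'⟩ := (hlim.inv₀ hℓ).isBoundedUnder_le
  obtain ⟨d, hd⟩ := ((tendsto_id (x := 𝓝 c₀)).norm.mul_const B).isBoundedUnder_le
  rw [eventually_map] at hb hb' hd
  refine ⟨max (a + 1) (max b (max b' d)), ?_⟩
  filter_upwards [(hcurve.and (hb.and hb')).prod_mk hd] with p hp t
  obtain ⟨⟨hu, hv, hv'⟩, hc⟩ := hp
  rw [hspeed p.1 0 t] at hv hv'
  simp only [firstJet, norm_prod_le_iff, norm_norm, norm_inv]
  simp only [le_max_iff]
  have hL := hB p.2 t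
  exact ⟨.inl (hu t), .inr (.inl hv), .inr (.inr (.inl hv')),
    .inr (.inr (.inr (hL.1.trans hc))), .inr (.inr (.inr (hL.2.trans hc)))⟩

theorem tendsto_firstJet_linearCombination {ι : Type*} [Fintype ι] {e : ι → ℝ → 𝔼}
    (he : ∀ i, IsW22 (e i)) (c₀ : ι → ℝ) {t : ℝ} (ht₀ : deriv u₀ t ≠ 0)
    (hu : Tendsto (fun n => u n t) atTop (𝓝 (u₀ t)))
    (hu' : Tendsto (fun n => deriv (u n) t) atTop (𝓝 (deriv u₀ t))) :
    Tendsto (fun p : ℕ × (ι → ℝ) => firstJet (u p.1) (Fintype.linearCombination ℝ e p.2) t)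
      (atTop ×ˢ 𝓝 c₀) (𝓝 (firstJet u₀ (Fintype.linearCombination ℝ e c₀) t)) := by
  have hlin (f : ι → 𝔼) : Tendsto (fun p : ℕ × (ι → ℝ) => Fintype.linearCombination ℝ f p.2)
      (atTop ×ˢ 𝓝 c₀) (𝓝 (Fintype.linearCombination ℝ f c₀)) :=
    ((Fintype.linearCombination ℝ f).continuous_of_finiteDimensional.tendsto c₀).comp tendsto_snd
  have hderiv := hu'.comp (tendsto_fst (g := 𝓝 c₀))
  simp only [firstJet, IsW22.deriv_linearCombination he, linearCombination_fun_apply]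
  exact (hu.comp tendsto_fst).prodMk_nhds (hderiv.prodMk_nhds
    ((hderiv.norm.inv₀ (norm_ne_zero_iff.mpr ht₀)).prodMk_nhds ((hlin _).prodMk_nhds (hlin _))))

end Sequence

theorem eventually_forall_mem_of_isCompact {ι X : Type*} [TopologicalSpace X] {l : Filter ι}
    {K : Set X} (hK : IsCompact K) {p : ι × X → Prop}
    (hp : ∀ x ∈ K, ∀ᶠ y in l ×ˢ 𝓝 x, p y) : ∀ᶠ i in l, ∀ x ∈ K, p (i, x) := by
  simp only [← eventually_iSup, ← hK.prod_nhdsSet_eq_biSup] at hp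
  exact hp.curry.mono fun _ h => h.self_of_nhdsSet

theorem eventually_forall_neg_of_homogeneous {ι E : Type*} [NormedAddCommGroup E]
    [NormedSpace ℝ E] [ProperSpace E] {l : Filter ι} {F : ι → E → ℝ}
    (hF : ∀ᶠ i in l, ∀ (a : ℝ) c, F i (a • c) = a ^ 2 * F i c)
    (hneg : ∀ c, c ≠ 0 → ∀ᶠ p in l ×ˢ 𝓝 c, F p.1 p.2 < 0) :
    ∀ᶠ i in l, ∀ c, c ≠ 0 → F i c < 0 := by
  filter_upwards [hF, eventually_forall_mem_of_isCompact (isCompact_sphere (0 : E) 1)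
    fun c hc => hneg c (ne_zero_of_mem_unit_sphere ⟨c, hc⟩)] with i hFi hi c hc
  have hnorm : ‖c‖ ≠ 0 := norm_ne_zero_iff.mpr hc
  rw [← smul_inv_smul₀ hnorm c, hFi]
  exact mul_neg_of_pos_of_neg (by positivity)
    (hi _ (by simp [norm_smul, hnorm]))

section Homogeneity

variable {M : Set (EuclideanSpace ℝ (Fin q))} {u v : ℝ → EuclideanSpace ℝ (Fin q)}

theorem covDeriv_smul (M : Set 𝔼) (u w : ℝ → 𝔼) (c : ℝ) :
    covDeriv M u (c • w) = c • covDeriv M u w := by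
  funext t
  rw [covDeriv, deriv_const_smul_field, map_smul, smul_comm, Pi.smul_apply, covDeriv]

theorem curvatureSecondVariation_smul {ν : ℕ∞} {m : ℕ} (hν : 3 ≤ ν) (hM : IsSubmanifold ν m M)
    (hu : IsImmersion M u) (hv : v ∈ fieldsAlong M u) (c t : ℝ) :
    curvatureSecondVariation M u (c • v) t = c ^ 2 * curvatureSecondVariation M u v t := by
  have hT : unitTangent u t ∈ tangentSpaceAt M (u t) :=
    Submodule.smul_mem _ _ (hu.deriv_mem_tangentSpaceAt t)
  have hR (X Y Z : 𝔼) := differentiableWithinAt_curvature hν hM (hu.mem t) X Y Z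
  have hR₁ (X Y Z : 𝔼) : curvature M (u t) (c • X) Y Z = c • curvature M (u t) X Y Z := by
    simpa using curvature_smul (M := M) (u t) X Y Z c 1 1
  have hR₂ (X Y Z : 𝔼) : curvature M (u t) X (c • Y) Z = c • curvature M (u t) X Y Z := by
    simpa using curvature_smul (M := M) (u t) X Y Z 1 c 1
  have hR₃ (X Y Z : 𝔼) : curvature M (u t) X Y (c • Z) = c • curvature M (u t) X Y Z := by
    simpa using curvature_smul (M := M) (u t) X Y Z 1 1 c
  have hDR₁ : curvatureDeriv M (u t) (unitTangent u t) (c • v t) (unitTangent u t) (c • v t) =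
      (c * c) • curvatureDeriv M (u t) (unitTangent u t) (v t) (unitTangent u t) (v t) := by
    simpa using curvatureDeriv_smul hT (hR _ _ _) 1 c 1 c
  have hDR₂ : curvatureDeriv M (u t) (c • v t) (c • v t) (unitTangent u t) (unitTangent u t) =
      (c * c) • curvatureDeriv M (u t) (v t) (v t) (unitTangent u t) (unitTangent u t) := by
    simpa using curvatureDeriv_smul (hv.2 t) (hR _ _ _) c c 1 1
  simp only [curvatureSecondVariation, covDeriv_smul, Pi.smul_apply, hR₁, hR₂, hR₃, hDR₁, hDR₂,
    real_inner_smul_left, real_inner_smul_right, norm_smul, mul_pow, Real.norm_eq_abs, sq_abs]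
  ring

theorem secondVariation_smul {ν : ℕ∞} {m : ℕ} (hν : 3 ≤ ν) (hM : IsSubmanifold ν m M)
    (hu : IsImmersion M u) (hv : v ∈ fieldsAlong M u) (σ c : ℝ) :
    secondVariation M σ u (c • v) = c ^ 2 * secondVariation M σ u v := by
  have hR₁ (t : ℝ) (X Y Z : 𝔼) : curvature M (u t) (c • X) Y Z = c • curvature M (u t) X Y Z := by
    simpa using curvature_smul (M := M) (u t) X Y Z c 1 1
  have hR₂₃ (t : ℝ) (X Y Z : 𝔼) :
      curvature M (u t) X (c • Y) (c • Z) = (c * c) • curvature M (u t) X Y Z := by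
    simpa using curvature_smul (M := M) (u t) X Y Z 1 c c
  simp only [secondVariation, curvatureSecondVariation_smul hν hM hu hv, covDeriv_smul,
    Pi.smul_apply, hR₁, hR₂₃, real_inner_smul_left, norm_smul, mul_pow, Real.norm_eq_abs, sq_abs]
  rw [mul_add, mul_add, mul_left_comm (c ^ 2), mul_left_comm (c ^ 2)]
  simp only [← intervalIntegral.integral_const_mul (c ^ 2)]
  congr 1
  · congr! 3 <;> funext t <;> ring
  · congr 1 with t
    ring

end Homogeneity

section Index

variable {M : Set (EuclideanSpace ℝ (Fin q))} {σ : ℝ} {u : ℝ → EuclideanSpace ℝ (Fin q)}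

theorem linearCombination_mem_fieldsAlong {ι : Type*} [Fintype ι] {e : ι → ℝ → 𝔼}
    (he : ∀ i, e i ∈ fieldsAlong M u) (c : ι → ℝ) :
    Fintype.linearCombination ℝ e c ∈ fieldsAlong M u := by
  rw [Fintype.linearCombination_apply]
  exact Submodule.sum_smul_mem _ _ fun i _ => he i

theorem natCast_le_index {ν : ℕ∞} {m : ℕ} (hν : 3 ≤ ν) (hM : IsSubmanifold ν m M)
    (hu : IsImmersion M u) {k : ℕ} {e : Fin k → ℝ → 𝔼} (he : ∀ i, e i ∈ fieldsAlong M u)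
    (hneg : ∀ c, c ≠ 0 → secondVariation M σ u (Fintype.linearCombination ℝ e c) < 0) :
    (k : ℕ∞) ≤ index M σ u := by
  have hzero : secondVariation M σ u 0 = 0 := by
    simpa using secondVariation_smul hν hM hu (fieldsAlong M u).zero_mem σ 0
  have hindep : LinearIndependent ℝ e := by
    rw [linearIndependent_iff_injective_fintypeLinearCombination, injective_iff_map_eq_zero]
    intro c hc
    by_contra hc₀
    exact (hneg c hc₀).ne (by rw [hc, hzero])
  have hnegDef : IsNegDefOn M σ u (Submodule.span ℝ (range e)) := by
    refine ⟨Submodule.span_le.mpr (range_subset_iff.mpr he), fun v hv hv₀ => ?_⟩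
    rw [← Fintype.range_linearCombination] at hv
    obtain ⟨c, rfl⟩ := hv
    exact hneg c fun hc => hv₀ (by rw [hc, map_zero])
  refine le_trans ?_ (le_iSup (fun V : {V // IsNegDefOn M σ u V} =>
    Cardinal.toENat (Module.rank ℝ V.1)) ⟨_, hnegDef⟩)
  simp [rank_span hindep, Cardinal.mk_range_eq _ hindep.injective]

theorem IsNegDefOn.exists_family {V : Submodule ℝ (ℝ → 𝔼)} (hV : IsNegDefOn M σ u V) {k : ℕ}
    (hk : (k : ℕ∞) ≤ Cardinal.toENat (Module.rank ℝ V)) :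
    ∃ e : Fin k → ℝ → 𝔼, (∀ i, e i ∈ fieldsAlong M u) ∧
      ∀ c, c ≠ 0 → secondVariation M σ u (Fintype.linearCombination ℝ e c) < 0 := by
  rw [Cardinal.natCast_le_toENat, Module.le_rank_iff] at hk
  obtain ⟨v, hv⟩ := hk
  have hindep : LinearIndependent ℝ fun i => (v i : ℝ → 𝔼) := hv.map' V.subtype V.ker_subtype
  refine ⟨fun i => v i, fun i => hV.1 (v i).2, fun c hc => hV.2 _ ?_ ?_⟩
  · rw [Fintype.linearCombination_apply]
    exact Submodule.sum_smul_mem _ _ fun i _ => (v i).2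
  · rw [linearIndependent_iff_injective_fintypeLinearCombination] at hindep
    exact (map_ne_zero_iff _ hindep).mpr hc

end Index

section LowerSemicontinuity

variable {M : Set (EuclideanSpace ℝ (Fin q))}
  {A : EuclideanSpace ℝ (Fin q) → EuclideanSpace ℝ (Fin q) →L[ℝ] EuclideanSpace ℝ (Fin q)}
  {σ : ℕ → ℝ} {u : ℕ → ℝ → EuclideanSpace ℝ (Fin q)} {u₀ : ℝ → EuclideanSpace ℝ (Fin q)}

theorem projField_linearCombination {ι : Type*} [Fintype ι] (A : 𝔼 → 𝔼 →L[ℝ] 𝔼) (u : ℝ → 𝔼)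
    (e : ι → ℝ → 𝔼) (c : ι → ℝ) : projField A u (Fintype.linearCombination ℝ e c) =
      Fintype.linearCombination ℝ (fun i => projField A u (e i)) c := by
  funext t
  simp only [projField, linearCombination_fun_apply, Fintype.linearCombination_apply, map_sum,
    map_smul]

theorem tendsto_secondVariation_projField_linearCombination {ι : Type*} [Fintype ι]
    (hA : ContDiff ℝ 2 A) (hadapted : ∀ᶠ n in atTop, IsAdapted M A (u n))
    (hσ : Tendsto σ atTop (𝓝 0)) (hu : ∀ n, IsImmersion M (u n))
    (hspeed : ∀ n s t, ‖deriv (u n) s‖ = ‖deriv (u n) t‖)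
    (hentropy : Tendsto (fun n => σ n ^ 2 *
      ∫ t in (0 : ℝ)..(2 * π), geodesicCurvature M (u n) t ^ 2 * ‖deriv (u n) t‖) atTop (𝓝 0))
    (hu₀ : IsImmersion M u₀) (hAM : ∀ t, A =ᶠ[𝓝[M] u₀ t] tangentProj M)
    (hunif : TendstoUniformly u u₀ atTop)
    (hderiv : ∀ᵐ t, Tendsto (fun n => deriv (u n) t) atTop (𝓝 (deriv u₀ t)))
    {e : ι → ℝ → 𝔼} (he : ∀ i, e i ∈ fieldsAlong M u₀) (c₀ : ι → ℝ) :
    Tendsto (fun p : ℕ × (ι → ℝ) => secondVariation M (σ p.1) (u p.1)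
        (projField A (u p.1) (Fintype.linearCombination ℝ e p.2))) (atTop ×ˢ 𝓝 c₀)
      (𝓝 (secondVariation M 0 u₀ (Fintype.linearCombination ℝ e c₀))) := by
  have heW (i : ι) : IsW22 (e i) := (he i).1
  obtain ⟨ℓ, hℓ, hlim⟩ := exists_tendsto_speed hu₀.deriv_ne_zero hspeed hderiv
  obtain ⟨r, hr⟩ :=
    exists_eventually_norm_firstJet_le hu₀.isW22 hspeed hunif hℓ (hlim 0) heW c₀
  have hjets : ∀ᵐ t, Tendsto
      (fun p : ℕ × (ι → ℝ) => firstJet (u p.1) (Fintype.linearCombination ℝ e p.2) t)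
      (atTop ×ˢ 𝓝 c₀) (𝓝 (firstJet u₀ (Fintype.linearCombination ℝ e c₀) t)) := by
    filter_upwards [hderiv] with t ht
    exact tendsto_firstJet_linearCombination heW c₀ (hu₀.deriv_ne_zero t)
      (hunif.tendsto_at t) ht
  have hκ := tendsto_sq_mul_integral_geodesicCurvature_sq hu hspeed hentropy hℓ (hlim 0)
  exact tendsto_secondVariation_projField hA (tendsto_fst.eventually hadapted)
    (fun p => IsW22.linearCombination heW p.2) hr hjets
    (tendsto_sq_mul_jetEnergy hA.continuous hadapted hσ hκ heW c₀) hu₀ hAM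
    (linearCombination_mem_fieldsAlong he c₀)

theorem index_le_liminf_index_of_tendsto {ι : Type*} {l : Filter ι} {ν : ℕ∞} {m : ℕ} (hν : 3 ≤ ν)
    (hM : IsSubmanifold ν m M) (hA : ContDiff ℝ 2 A) {σ : ι → ℝ} {σ₀ : ℝ} {u : ι → ℝ → 𝔼}
    (hadapted : ∀ᶠ i in l, IsAdapted M A (u i))
    (hlim : ∀ (k : ℕ) (e : Fin k → ℝ → 𝔼), (∀ j, e j ∈ fieldsAlong M u₀) → ∀ c₀,
      Tendsto (fun p : ι × (Fin k → ℝ) => secondVariation M (σ p.1) (u p.1)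
          (projField A (u p.1) (Fintype.linearCombination ℝ e p.2))) (l ×ˢ 𝓝 c₀)
        (𝓝 (secondVariation M σ₀ u₀ (Fintype.linearCombination ℝ e c₀)))) :
    index M σ₀ u₀ ≤ liminf (fun i => index M (σ i) (u i)) l := by
  refine iSup_le fun ⟨V, hV⟩ => ENat.forall_natCast_le_iff_le.mp fun k hk => ?_
  obtain ⟨e, he, hneg⟩ := hV.exists_family hk
  have hproj {i : ι} (hi : IsAdapted M A (u i)) (j : Fin k) :
      projField A (u i) (e j) ∈ fieldsAlong M (u i) :=
    hi.projField_mem_fieldsAlong hA (he j).1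
  have hneg_proj : ∀ᶠ i in l, ∀ c, c ≠ 0 → secondVariation M (σ i) (u i)
      (projField A (u i) (Fintype.linearCombination ℝ e c)) < 0 := by
    refine eventually_forall_neg_of_homogeneous ?_ fun c hc =>
      (hlim k e he c).eventually_lt_const (hneg c hc)
    filter_upwards [hadapted] with i hi a c
    rw [projField_linearCombination, projField_linearCombination, map_smul]
    exact secondVariation_smul hν hM hi.isImmersion
      (linearCombination_mem_fieldsAlong (hproj hi) c) _ a
  refine le_liminf_of_le (by isBoundedDefault) ?_
  filter_upwards [hadapted, hneg_proj] with i hi hneg_i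
  refine natCast_le_index hν hM hi.isImmersion (hproj hi) fun c hc => ?_
  rw [← projField_linearCombination]
  exact hneg_i c hc

end LowerSemicontinuity

theorem theorem9p3_general {m : ℕ} {ν : ℕ∞} (hν : 3 ≤ ν) {M : Set 𝔼} (hM : IsSubmanifold ν m M)
    {σ : ℕ → ℝ} (hσ : Tendsto σ atTop (𝓝 0)) {u : ℕ → ℝ → 𝔼} (hu : ∀ n, IsImmersion M (u n))
    (hu_speed : ∀ n s t, ‖deriv (u n) s‖ = ‖deriv (u n) t‖)
    (hu_entropy : Tendsto (fun n => σ n ^ 2 *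
      ∫ t in (0 : ℝ)..(2 * π), geodesicCurvature M (u n) t ^ 2 * ‖deriv (u n) t‖) atTop (𝓝 0))
    {u₀ : ℝ → 𝔼} (hu₀ : IsImmersion M u₀) (hu_unif : TendstoUniformly u u₀ atTop)
    (hu_deriv : ∀ᵐ t, Tendsto (fun n => deriv (u n) t) atTop (𝓝 (deriv u₀ t))) :
    index M 0 u₀ ≤ liminf (fun n => index M (σ n) (u n)) atTop := by
  have hcompact : IsCompact (range u₀) :=
    hu₀.isW22.periodic.compact_of_continuous Real.two_pi_pos.ne' hu₀.isW22.continuous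
  obtain ⟨A, U, hA, hU, hu₀U, hAM⟩ :=
    hM.exists_contDiff_eqOn_tangentProj hν hcompact (range_subset_iff.mpr hu₀.mem)
  rw [range_subset_iff] at hu₀U
  have hAM₀ (t : ℝ) : A =ᶠ[𝓝[M] u₀ t] tangentProj M :=
    hAM.eventuallyEq_of_mem (inter_mem_nhdsWithin M (hU.mem_nhds (hu₀U t)))
  have hadapted := eventually_isAdapted hU hu₀.isW22 hu₀U hAM hu hu_speed hu_unif
  exact index_le_liminf_index_of_tendsto hν hM hA hadapted fun _ _ he c =>
    tendsto_secondVariation_projField_linearCombination hA hadapted hσ hu hu_speed hu_entropy hu₀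
      hAM₀ hu_unif hu_deriv he c

end ViscosityGeodesic

end

open ViscosityGeodesic in
theorem theorem9p3 {q : ℕ} (m : ℕ) (ν : ℕ∞) (hν : 3 ≤ ν)
    (M : Set (EuclideanSpace ℝ (Fin q))) (hM : IsCompact M) (hMν : IsSubmanifold ν m M)
    (σ : ℕ → ℝ) (hσ_pos : ∀ n, 0 < σ n) (hσ : Tendsto σ atTop (𝓝 0))
    (u : ℕ → ℝ → EuclideanSpace ℝ (Fin q))
    (hu_crit : ∀ n, IsCritical M (σ n) (u n))
    (hu_speed : ∀ n s t, ‖deriv (u n) s‖ = ‖deriv (u n) t‖)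
    (hu_entropy : Tendsto (fun n => σ n ^ 2 *
      ∫ t in (0 : ℝ)..(2 * π), geodesicCurvature M (u n) t ^ 2 * ‖deriv (u n) t‖) atTop (𝓝 0))
    (u₀ : ℝ → EuclideanSpace ℝ (Fin q)) (hu₀ : IsClosedGeodesic M u₀)
    (hu_unif : TendstoUniformly u u₀ atTop)
    (hu_deriv : ∀ᵐ t, Tendsto (fun n => deriv (u n) t) atTop (𝓝 (deriv u₀ t))) :
    index M 0 u₀ ≤ liminf (fun n => index M (σ n) (u n)) atTop := by
  exact theorem9p3_general hν hMν hσ (fun n => (hu_crit n).1) hu_speed hu_entropy hu₀.1 hu_unif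
    hu_deriv
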